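/- **Model ($\mathrm{KT}_1$ LOCAL).** A network is a finite connected undirected graph $G=(V,E)$ with $n=|V|$ nodes and diameter $D$; the nodes carry distinct identifiers (arbitrary natural numbers). Initially a node knows its own identifier, the identifiers of its neighbours, and an estimate of $n$. All nodes run the same program in synchronous rounds. In each round a running node tosses finitely many private independent fair coins, performs arbitrary local computation on its state, its coin tosses and the messages it has just received (each labelled by the identifier of its sender), and sends at most one message, of unrestricted size, to each of its neighbours, possibly different messages to different neighbours. A node may halt with an output; after that it does nothing. An execution elects a leader within $R$ rounds if after some $T\le R$ rounds all nodes have halted and there is a node $\ell$ such that every node outputs the identifier of $\ell$. The number of messages of an execution is the total number of messages sent over all rounds by all nodes. **Statement.** Let $a\ge 1$ be a real constant and $c\ge 0$ an integer constant. There are a randomized algorithm in the $\mathrm{KT}_1$ LOCAL model and a constant $C$, both depending only on $a$ and $c$, such that for every network in which the estimate $N_v$ of every node $v$ is a natural number satisfying $n/a\le N_v\le a\,n$, with probability at least $1-n^{-c}$ the algorithm elects a leader within $C\,(D\log n+\log^3 n)$ rounds and sends at most $C\, n\log^4 n$ messages. -/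

import Mathlib

open MeasureTheory

universe u

/-- What a node knows before the first round in the `KT1` model: its own identifier, the
identifiers of its neighbours, and its estimate of the number of nodes. -/
structure LocalInput where
  id : ℕ
  nbrIds : Finset ℕ
  estimate : ℕ

/-- A randomized distributed algorithm for the synchronous `KT1` LOCAL model: one program,
executed by every node of every network. Messages are elements of an arbitrary type (no size
restriction), local computation is arbitrary, and in each round a node may toss finitely many
private fair coins. Messages are addressed, and received messages are labelled, by identifiers
of neighbours. -/
structure KT1LocalAlgorithm where
  /-- local states -/
  State : Type
  /-- messages -/
  Msg : Type
  /-- the initial state -/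
  init : LocalInput → State
  /-- `output s = some x` means that a node in state `s` has halted with output `x`;
  `output s = none` means that it is still running -/
  output : State → Option ℕ
  /-- the number of coins that a node in a given state tosses in the coming round -/
  coins : State → ℕ
  /-- one round: from the current state, the outcomes of the coin tosses and the received messages
  (by identifier of the sender) to the new state and the messages to be sent (by identifier of
  the addressee) -/
  step : State → List Bool → (ℕ → Option Msg) → State × (ℕ → Option Msg)

/-- A communication network: a graph on the set `V` of nodes, with an identifier and an estimate of
the number of nodes at each node. -/
structure Network (V : Type u) where
  graph : SimpleGraph V
  id : V → ℕ
  estimate : V → ℕ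

/-- The outcomes of all coins: `ω (v, t, i)` is the `i`-th coin available to node `v` in
round `t`. -/
abbrev CoinTosses (V : Type u) : Type u := V × ℕ × ℕ → Bool

/-- All coins are fair and independent. -/
noncomputable def coinMeasure (V : Type u) : Measure (CoinTosses V) :=
  Measure.infinitePi fun _ => (PMF.uniformOfFintype Bool).toMeasure

namespace KT1LocalAlgorithm

/-- A global configuration between two rounds: the state of every node, and for each ordered pair
`(u, v)` the message (if any) that `u` sent to `v` in the previous round. -/
structure Config (A : KT1LocalAlgorithm) (V : Type u) where
  state : V → A.State
  transit : V → V → Option A.Msg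

variable {V : Type u}

open Classical in
/-- The initial knowledge of node `v`. -/
noncomputable def localInput [Fintype V] (N : Network V) (v : V) : LocalInput where
  id := N.id v
  nbrIds := (Finset.univ.filter fun w => N.graph.Adj v w).image N.id
  estimate := N.estimate v

open Classical in
/-- The messages that reach `v`, labelled by the identifiers of their senders. (Identifiers are
unique in the networks considered, so the sender is determined by its label.) -/
noncomputable def inbox (A : KT1LocalAlgorithm) (N : Network V) (c : A.Config V) (v : V) :
    ℕ → Option A.Msg :=
  fun i => if h : ∃ u, N.graph.Adj u v ∧ N.id u = i then c.transit h.choose v else none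

/-- The action of node `v` in round `t`. A halted node keeps its state and sends nothing. -/
noncomputable def nodeStep (A : KT1LocalAlgorithm) (N : Network V) (ω : CoinTosses V) (t : ℕ)
    (c : A.Config V) (v : V) : A.State × (ℕ → Option A.Msg) :=
  if (A.output (c.state v)).isSome then (c.state v, fun _ => none)
  else A.step (c.state v) (List.ofFn fun i : Fin (A.coins (c.state v)) => ω (v, t, (i : ℕ)))
    (A.inbox N c v)

open Classical in
/-- The configuration after `t` rounds (rounds are numbered from `0`). Messages travel only along
edges of the graph. -/
noncomputable def run [Fintype V] (A : KT1LocalAlgorithm) (N : Network V) (ω : CoinTosses V) :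
    ℕ → A.Config V
  | 0 => { state := fun v => A.init (localInput N v), transit := fun _ _ => none }
  | t + 1 =>
    { state := fun v => (A.nodeStep N ω t (A.run N ω t) v).1
      transit := fun v w =>
        if N.graph.Adj v w then (A.nodeStep N ω t (A.run N ω t) v).2 (N.id w) else none }

open Classical in
/-- The number of messages sent by all nodes in round `t`. -/
noncomputable def messagesInRound [Fintype V] (A : KT1LocalAlgorithm) (N : Network V)
    (ω : CoinTosses V) (t : ℕ) : ℕ :=
  (Finset.univ.filter fun e : V × V => ((A.run N ω (t + 1)).transit e.1 e.2).isSome).card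

/-- The total number of messages sent throughout the execution is at most `M`. -/
def MessagesAtMost [Fintype V] (A : KT1LocalAlgorithm) (N : Network V) (ω : CoinTosses V)
    (M : ℝ) : Prop :=
  ∀ T : ℕ, ((∑ t ∈ Finset.range T, A.messagesInRound N ω t : ℕ) : ℝ) ≤ M

/-- After some number `T ≤ R` of rounds all nodes have halted, and a unique leader `ℓ` has been
elected: the output of every node is the identifier of `ℓ`. -/
def ElectsLeaderWithin [Fintype V] (A : KT1LocalAlgorithm) (N : Network V) (ω : CoinTosses V)
    (R : ℝ) : Prop :=
  ∃ T : ℕ, (T : ℝ) ≤ R ∧ ∃ l : V, ∀ v : V, A.output ((A.run N ω T).state v) = some (N.id l)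

end KT1LocalAlgorithm

/-!
Every node tosses `K = Θ(log n)` coins, and a node whose first `g` coins show heads opens a cluster
in phase `K - g` unless it has joined one before; clusters grow by one layer per phase. Thus a node
joins in the phase `min_u (start u + dist u v)`. Phase `q` occupies the rounds from `q ^ 2` to
`(q + 1) ^ 2 - 1`, which suffices for a cluster to gather what its members know at the centre and
to broadcast it. As nodes know the identifiers of their neighbours, a cluster can then contact each
adjacent outside node through a single edge. Leading runs of heads are memoryless: if `r` nodes
could reach `x` by phase `τ + 2`, then one of them reaches `x` before phase `τ`, except with
probability `(7/8) ^ r`. Hence only `O(log n)` centres are near any node, and the edges used for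
contacts form a spanner with `O(n log n)` edges and stretch `O(log n)`.

Each of the `Θ(log n)` random candidates then floods the spanner with a wave that is echoed back. A
candidate whose echo is complete knows the whole network; it spreads this knowledge along the
spanner, and every node outputs the smallest identifier. Nodes send messages only when they have
news, so that every wave crosses every spanner edge a constant number of times.
-/

section ShiftedDist

variable {V : Type u} {G : SimpleGraph V} {s : V → ℕ} {v w : V}

theorem dist_le_dist_add_one_of_adj (hG : G.Connected) (h : G.Adj v w) (u : V) :
    G.dist u w ≤ G.dist u v + 1 :=
  SimpleGraph.dist_eq_one_iff_adj.2 h ▸ hG.dist_triangle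

/-- The time at which `v` is reached by the first of several signals, when every node `u` emits a
signal at time `s u` and signals cross one edge per unit of time. -/
noncomputable def shiftedDist (G : SimpleGraph V) (s : V → ℕ) (v : V) : ℕ :=
  ⨅ u, s u + G.dist u v

theorem shiftedDist_le (u v : V) : shiftedDist G s v ≤ s u + G.dist u v :=
  ciInf_le (OrderBot.bddBelow _) u

theorem shiftedDist_le_self (v : V) : shiftedDist G s v ≤ s v := by
  simpa only [SimpleGraph.dist_self, add_zero] using shiftedDist_le (G := G) (s := s) v v

theorem exists_add_dist_eq_shiftedDist (G : SimpleGraph V) (s : V → ℕ) (v : V) :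
    ∃ u, s u + G.dist u v = shiftedDist G s v :=
  have : Nonempty V := ⟨v⟩
  Nat.sInf_mem (Set.range_nonempty fun u => s u + G.dist u v)

theorem shiftedDist_le_add_one (hG : G.Connected) (h : G.Adj v w) :
    shiftedDist G s w ≤ shiftedDist G s v + 1 := by
  obtain ⟨u, hu⟩ := exists_add_dist_eq_shiftedDist G s v
  have := dist_le_dist_add_one_of_adj hG h u
  have := shiftedDist_le (G := G) (s := s) u w
  omega

theorem shiftedDist_eq_self_or_exists_adj (hG : G.Connected) (v : V) :
    shiftedDist G s v = s v ∨ ∃ w, G.Adj w v ∧ shiftedDist G s w + 1 = shiftedDist G s v := by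
  obtain ⟨u, hu⟩ := exists_add_dist_eq_shiftedDist G s v
  obtain ⟨p, hp⟩ := (hG v u).exists_walk_length_eq_dist
  cases p with
  | nil => exact Or.inl (by simpa only [SimpleGraph.dist_self, add_zero] using hu.symm)
  | @cons _ w _ h q =>
    refine Or.inr ⟨w, h.symm, ?_⟩
    rw [SimpleGraph.Walk.length_cons, SimpleGraph.dist_comm] at hp
    have hq : G.dist u w ≤ q.length := SimpleGraph.dist_comm (G := G) ▸ SimpleGraph.dist_le q
    have := shiftedDist_le (G := G) (s := s) u w
    have := shiftedDist_le_add_one (s := s) hG h.symm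
    omega

end ShiftedDist

/-! ### The algorithm -/

/-- What nodes record about themselves and tell each other. Nodes are named by their
identifiers. -/
inductive LocalFact where
  /-- the node `i` has the set `nbrs` of neighbours -/
  | node (i : ℕ) (nbrs : Finset ℕ)
  /-- the node `i`, with the set `nbrs` of neighbours, has joined the cluster with centre `c` in
  phase `q` -/
  | member (i : ℕ) (nbrs : Finset ℕ) (c q : ℕ)
  /-- the wave of the candidate `x` has reached the node `i` in round `r` -/
  | adopt (i x r : ℕ)
  /-- the node `i` has finished the echo of the wave of the candidate `x` -/
  | done (i x : ℕ)

/-- The node that a fact is about; it is the only node that ever creates this fact. -/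
def LocalFact.owner : LocalFact → ℕ
  | node i _ => i
  | member i _ _ _ => i
  | adopt i _ _ => i
  | done i _ => i

/-- The parameters of the algorithm, as functions of the estimate of the number of nodes: the
number of coins tossed, the round in which a node starts to take part in waves, and the number of
leading heads that makes a node a candidate for leadership. -/
structure ElectionParams where
  coinCount : ℕ → ℕ
  wakeRound : ℕ → ℕ
  candidateHeads : ℕ → ℕ

/-- The local state of a node. The field `round` is the number of the coming round, `heads` the
number of leading heads among its coins, and `peers` the set of neighbours with which it
exchanges messages. -/
structure NodeState where
  input : LocalInput
  round : ℕ
  heads : ℕ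
  peers : Set ℕ
  knowledge : Set LocalFact
  output : Option ℕ

/-- The length of the longest prefix of heads (`true`) in a sequence of coin tosses. -/
def leadingHeads (l : List Bool) : ℕ :=
  Nat.findGreatest (fun j => ∀ i < j, l.getD i false = true) l.length

namespace NodeState

/-- The number of leading heads once the coins of the coming round are tossed; all coins that
matter are tossed in round `0`. -/
def headsAfter (s : NodeState) (coins : List Bool) : ℕ :=
  if s.round = 0 then leadingHeads coins else s.heads

/-- The facts known once the messages `m` have been read. -/
def received (s : NodeState) (m : ℕ → Option (Set LocalFact)) : Set LocalFact :=
  s.knowledge ∪ {f | ∃ i K, m i = some K ∧ f ∈ K}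

open Classical in
/-- The fact by which a node that is not yet in a cluster joins one: the cluster of a sender if
there is one, otherwise its own cluster if its phase `start` begins in this round. Phase `q`
consists of the rounds `q ^ 2, …, (q + 1) ^ 2 - 1`. -/
noncomputable def joinFacts (s : NodeState) (start : ℕ) (m : ℕ → Option (Set LocalFact)) :
    Set LocalFact :=
  if ∃ nbrs c q, .member s.input.id nbrs c q ∈ s.received m then ∅
  else if h : ∃ cq : ℕ × ℕ, ∃ i K nbrs, m i = some K ∧ .member i nbrs cq.1 cq.2 ∈ K then
    {.member s.input.id s.input.nbrIds h.choose.1 (h.choose.2 + 1)}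
  else if s.round = start ^ 2 then {.member s.input.id s.input.nbrIds s.input.id start}
  else ∅

/-- The facts known after the attempt to join a cluster. -/
noncomputable def clustered (s : NodeState) (start : ℕ) (m : ℕ → Option (Set LocalFact)) :
    Set LocalFact :=
  s.received m ∪ s.joinFacts start m

/-- The neighbours outside its cluster that a node contacts at the end of the phase in which it
has joined, given the set `K` of known facts. Among the members of the cluster adjacent to such a
neighbour only one makes the contact: the first in the order by phase and identifier. -/
def contacts (s : NodeState) (K : Set LocalFact) : Set ℕ :=
  {x | x ∈ s.input.nbrIds ∧ ∃ c q, .member s.input.id s.input.nbrIds c q ∈ K ∧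
    s.round + 1 = (q + 1) ^ 2 ∧ ∀ i nbrs q', .member i nbrs c q' ∈ K →
      i ≠ x ∧ (x ∈ nbrs → q < q' ∨ q = q' ∧ s.input.id ≤ i)}

/-- The peers after a round: contacts are symmetric, as senders become peers. -/
def newPeers (s : NodeState) (m : ℕ → Option (Set LocalFact)) (K : Set LocalFact) : Set ℕ :=
  s.peers ∪ {i | (m i).isSome} ∪ s.contacts K

/-- The waves that a node adopts: its own if it is a candidate, and those of its peers in `P`. -/
def adoptFacts (s : NodeState) (isCandidate : Prop) (P : Set ℕ) (K : Set LocalFact) :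
    Set LocalFact :=
  {f | ∃ x, f = .adopt s.input.id x s.round ∧ (∀ r, .adopt s.input.id x r ∉ K) ∧
    (x = s.input.id ∧ isCandidate ∨ ∃ i ∈ P, ∃ r, .adopt i x r ∈ K)}

/-- The waves whose echo a node finishes: all peers in `P` have adopted the wave, and those that
have adopted it later than the node itself have finished their echos. -/
def doneFacts (s : NodeState) (P : Set ℕ) (K : Set LocalFact) : Set LocalFact :=
  {f | ∃ x, f = .done s.input.id x ∧ ∃ r, .adopt s.input.id x r ∈ K ∧
    ∀ i ∈ P, ∃ r', .adopt i x r' ∈ K ∧ (r < r' → .done i x ∈ K)}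

/-- The facts known after the treatment of waves and echos, in which only awake nodes take
part. -/
def waved (s : NodeState) (awake isCandidate : Prop) (P : Set ℕ) (K : Set LocalFact) :
    Set LocalFact :=
  {f | f ∈ K ∨ awake ∧ f ∈ s.adoptFacts isCandidate P K ∨
    awake ∧ f ∈ s.doneFacts P (K ∪ s.adoptFacts isCandidate P K)}

end NodeState

/-- The set of nodes described by `K` is closed under adjacency, so that in a connected network it
consists of all nodes. -/
def AdjacencyClosed (K : Set LocalFact) : Prop :=
  ∀ i nbrs, .node i nbrs ∈ K → ∀ j ∈ nbrs, ∃ nbrs', .node j nbrs' ∈ K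

open Classical in
/-- One round of a node. Awake nodes send messages only if they have created a fact or halt. -/
noncomputable def nodeRound (P : ElectionParams) (s : NodeState) (coins : List Bool)
    (m : ℕ → Option (Set LocalFact)) : NodeState × (ℕ → Option (Set LocalFact)) :=
  let heads := s.headsAfter coins
  let clustered := s.clustered (P.coinCount s.input.estimate - heads) m
  let peers := s.newPeers m clustered
  let awake := P.wakeRound s.input.estimate ≤ s.round
  let waved := s.waved awake (P.candidateHeads s.input.estimate ≤ heads) peers clustered
  let halts := awake ∧ AdjacencyClosed waved
  ({ input := s.input
     round := s.round + 1
     heads := heads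
     peers := peers
     knowledge := waved
     output := if halts then some (sInf {i | ∃ nbrs, .node i nbrs ∈ waved}) else none },
    fun i => if i ∈ peers ∧ (¬ awake ∨ halts ∨ ∃ f ∈ waved, f ∉ clustered) then some waved
      else none)

/-- The leader election algorithm with parameters `P`. -/
noncomputable def electionAlgorithm (P : ElectionParams) : KT1LocalAlgorithm where
  State := NodeState
  Msg := Set LocalFact
  init I :=
    { input := I, round := 0, heads := 0, peers := ∅, knowledge := {.node I.id I.nbrIds},
      output := none }
  output s := s.output
  coins s := if s.round = 0 then P.coinCount s.input.estimate else 0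
  step := nodeRound P

section Heads

variable {V : Type u} {P : ElectionParams} {N : Network V} {ω : CoinTosses V} {v : V} {j : ℕ}

/-- The number of leading heads among the coins of the node `v`. -/
def nodeHeads (P : ElectionParams) (N : Network V) (ω : CoinTosses V) (v : V) : ℕ :=
  leadingHeads (List.ofFn fun i : Fin (P.coinCount (N.estimate v)) => ω (v, 0, (i : ℕ)))

theorem le_leadingHeads_iff {l : List Bool} (hj : j ≤ l.length) :
    j ≤ leadingHeads l ↔ ∀ i < j, l.getD i false = true := by
  refine ⟨fun h i hi => ?_, fun h => Nat.le_findGreatest hj h⟩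
  exact Nat.findGreatest_spec (P := fun j => ∀ i < j, l.getD i false = true)
    l.length.zero_le (fun i hi => absurd hi i.not_lt_zero) i (hi.trans_le h)

theorem le_nodeHeads_iff (hj : j ≤ P.coinCount (N.estimate v)) :
    j ≤ nodeHeads P N ω v ↔ ∀ i < j, ω (v, 0, i) = true := by
  rw [nodeHeads, le_leadingHeads_iff (by rwa [List.length_ofFn])]
  refine forall₂_congr fun i hi => ?_
  have : i < P.coinCount (N.estimate v) := hi.trans_le hj
  simp [List.getD, this]

end Heads

/-! ### Executions -/

/-- An execution of the election algorithm in which all nodes wake up between the rounds `firstWake`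
and `lastWake`, after the last phase. -/
structure Execution (V : Type u) [Fintype V] where
  network : Network V
  ω : CoinTosses V
  params : ElectionParams
  connected : network.graph.Connected
  injective : Function.Injective network.id
  firstWake : ℕ
  lastWake : ℕ
  firstWake_le : ∀ v, firstWake ≤ params.wakeRound (network.estimate v)
  le_lastWake : ∀ v, params.wakeRound (network.estimate v) ≤ lastWake
  startPhase_lt : ∀ v,
    (params.coinCount (network.estimate v) - nodeHeads params network ω v + 1) ^ 2 < firstWake

namespace Execution

variable {V : Type u} [Fintype V] (E : Execution V)

/-- The communication graph. -/
abbrev graph : SimpleGraph V := E.network.graph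

/-- The identifier of a node. -/
abbrev id (v : V) : ℕ := E.network.id v

open Classical in
/-- The identifiers of the neighbours of a node. -/
noncomputable def nbrIds (v : V) : Finset ℕ :=
  (Finset.univ.filter fun w => E.graph.Adj v w).image E.id

/-- The phase in which a node opens a cluster unless it has joined one before. -/
def startPhase (v : V) : ℕ :=
  E.params.coinCount (E.network.estimate v) - nodeHeads E.params E.network E.ω v

/-- The round in which a node starts to take part in waves. -/
def wakeRound (v : V) : ℕ := E.params.wakeRound (E.network.estimate v)

/-- The candidates are the nodes that start a wave. -/
def IsCandidate (v : V) : Prop :=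
  E.params.candidateHeads (E.network.estimate v) ≤ nodeHeads E.params E.network E.ω v

/-- The algorithm that is executed. -/
noncomputable def algorithm : KT1LocalAlgorithm := electionAlgorithm E.params

/-- The state of `v` before round `t`. -/
noncomputable def state (t : ℕ) (v : V) : NodeState :=
  (E.algorithm.run E.network E.ω t).state v

/-- The message that `v` has sent to `w` in the round before round `t`. -/
noncomputable def message (t : ℕ) (v w : V) : Option (Set LocalFact) :=
  (E.algorithm.run E.network E.ω t).transit v w

/-- The facts known to `v` before round `t`. -/
noncomputable def knowledge (t : ℕ) (v : V) : Set LocalFact := (E.state t v).knowledge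

/-- The identifiers of the peers of `v` before round `t`. -/
noncomputable def peers (t : ℕ) (v : V) : Set ℕ := (E.state t v).peers

/-- The node `v` has not halted before round `t`. -/
def Running (t : ℕ) (v : V) : Prop := (E.state t v).output = none

/-- The messages read by `v` in round `t`, labelled by the identifiers of their senders. -/
noncomputable def inbox (t : ℕ) (v : V) : ℕ → Option (Set LocalFact) :=
  E.algorithm.inbox E.network (E.algorithm.run E.network E.ω t) v

/-- The facts known to `v` in round `t` after reading its messages. -/
noncomputable def received (t : ℕ) (v : V) : Set LocalFact :=
  (E.state t v).received (E.inbox t v)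

/-- The fact, if any, by which `v` joins a cluster in round `t`. -/
noncomputable def joined (t : ℕ) (v : V) : Set LocalFact :=
  (E.state t v).joinFacts (E.startPhase v) (E.inbox t v)

/-- The facts known to `v` in round `t` after its attempt to join a cluster. -/
noncomputable def clustered (t : ℕ) (v : V) : Set LocalFact :=
  E.received t v ∪ E.joined t v

/-- The facts known to `v` in round `t` after the adoption of waves by an awake node. -/
noncomputable def adopted (t : ℕ) (v : V) : Set LocalFact :=
  E.clustered t v ∪
    (E.state t v).adoptFacts (E.IsCandidate v) (E.peers (t + 1) v) (E.clustered t v)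

/-- In round `t` the node `v`, if still running, sends messages to its peers. -/
def Sends (t : ℕ) (v : V) : Prop :=
  t < E.wakeRound v ∨ (E.wakeRound v ≤ t ∧ AdjacencyClosed (E.knowledge (t + 1) v)) ∨
    ∃ f ∈ E.knowledge (t + 1) v, f ∉ E.clustered t v

variable {E} {t t' : ℕ} {u v w : V} {i : ℕ} {f : LocalFact} {K : Set LocalFact}

theorem id_inj : E.id v = E.id w ↔ v = w := E.injective.eq_iff

theorem mem_nbrIds : i ∈ E.nbrIds v ↔ ∃ w, E.graph.Adj v w ∧ E.id w = i := by
  simp only [nbrIds, Finset.mem_image, Finset.mem_filter, Finset.mem_univ, true_and]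

theorem id_mem_nbrIds : E.id w ∈ E.nbrIds v ↔ E.graph.Adj v w := by
  simp only [mem_nbrIds, id_inj, exists_eq_right]

theorem inbox_id (h : E.graph.Adj u v) : E.inbox t v (E.id u) = E.message t u v := by
  have hex : ∃ u', E.network.graph.Adj u' v ∧ E.network.id u' = E.network.id u := ⟨u, h, rfl⟩
  rw [inbox, KT1LocalAlgorithm.inbox, dif_pos hex, E.injective hex.choose_spec.2]
  rfl

theorem exists_message_of_inbox (h : E.inbox t v i = some K) :
    ∃ u, E.graph.Adj u v ∧ E.id u = i ∧ E.message t u v = some K := by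
  by_cases hex : ∃ u, E.network.graph.Adj u v ∧ E.network.id u = i
  · obtain ⟨u, hu, rfl⟩ := hex
    exact ⟨u, hu, rfl, (inbox_id hu).symm.trans h⟩
  · rw [inbox, KT1LocalAlgorithm.inbox, dif_neg hex] at h
    contradiction

theorem output_isSome_iff :
    (E.algorithm.output ((E.algorithm.run E.network E.ω t).state v)).isSome ↔
      ¬ E.Running t v :=
  Option.isSome_iff_ne_none

theorem nodeStep_of_not_running (h : ¬ E.Running t v) :
    E.algorithm.nodeStep E.network E.ω t (E.algorithm.run E.network E.ω t) v =
      (E.state t v, fun _ => none) :=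
  if_pos (output_isSome_iff.2 h)

/-- The coins that `v` tosses in round `t`. -/
noncomputable def tosses (E : Execution V) (t : ℕ) (v : V) : List Bool :=
  List.ofFn fun i : Fin (E.algorithm.coins (E.state t v)) => E.ω (v, t, (i : ℕ))

theorem nodeStep_of_running (h : E.Running t v) :
    E.algorithm.nodeStep E.network E.ω t (E.algorithm.run E.network E.ω t) v =
      nodeRound E.params (E.state t v) (E.tosses t v) (E.inbox t v) :=
  if_neg (output_isSome_iff.not.2 (not_not.2 h))

theorem state_succ_of_not_running (h : ¬ E.Running t v) : E.state (t + 1) v = E.state t v :=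
  congrArg Prod.fst (nodeStep_of_not_running h)

theorem state_succ (h : E.Running t v) : E.state (t + 1) v =
    (nodeRound E.params (E.state t v) (E.tosses t v) (E.inbox t v)).1 :=
  congrArg Prod.fst (nodeStep_of_running h)

open Classical in
theorem message_succ_eq : E.message (t + 1) v w = if E.graph.Adj v w then
    (E.algorithm.nodeStep E.network E.ω t (E.algorithm.run E.network E.ω t) v).2 (E.id w)
    else none := rfl

theorem message_succ_of_not_running (h : ¬ E.Running t v) : E.message (t + 1) v w = none := by
  rw [message_succ_eq, nodeStep_of_not_running h]
  exact ite_self _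

theorem running_zero (v : V) : E.Running 0 v := rfl

theorem knowledge_zero (v : V) : E.knowledge 0 v = {.node (E.id v) (E.nbrIds v)} := rfl

theorem peers_zero (v : V) : E.peers 0 v = ∅ := rfl

theorem Running.of_succ (h : E.Running (t + 1) v) : E.Running t v := by
  by_contra hn
  rw [Running, state_succ_of_not_running hn] at h
  exact hn h

theorem input_eq (t : ℕ) (v : V) :
    (E.state t v).input = KT1LocalAlgorithm.localInput E.network v := by
  induction t with
  | zero => rfl
  | succ t ih =>
    by_cases h : E.Running t v
    · rw [state_succ h]; exact ih
    · rw [state_succ_of_not_running h]; exact ih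

theorem input_id (t : ℕ) (v : V) : (E.state t v).input.id = E.id v := by
  rw [input_eq]; rfl

theorem input_nbrIds (t : ℕ) (v : V) : (E.state t v).input.nbrIds = E.nbrIds v := by
  rw [input_eq]; rfl

theorem input_estimate (t : ℕ) (v : V) :
    (E.state t v).input.estimate = E.network.estimate v := by
  rw [input_eq]; rfl

theorem round_eq (h : E.Running t v) : (E.state t v).round = t := by
  induction t with
  | zero => rfl
  | succ t ih =>
    rw [state_succ h.of_succ]
    exact congrArg (· + 1) (ih h.of_succ)

theorem headsAfter_eq (h : E.Running t v) :
    (E.state t v).headsAfter (E.tosses t v) = nodeHeads E.params E.network E.ω v := by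
  induction t with
  | zero => rfl
  | succ t ih =>
    have hheads : (E.state (t + 1) v).heads = nodeHeads E.params E.network E.ω v := by
      rw [state_succ h.of_succ]
      exact ih h.of_succ
    rw [NodeState.headsAfter, round_eq h, if_neg (Nat.succ_ne_zero t), hheads]

theorem peers_succ (h : E.Running t v) :
    E.peers (t + 1) v = (E.state t v).newPeers (E.inbox t v) (E.clustered t v) := by
  rw [peers, state_succ h]
  simp only [nodeRound, headsAfter_eq h, input_estimate]
  rfl

theorem knowledge_succ (h : E.Running t v) :
    E.knowledge (t + 1) v = (E.state t v).waved (E.wakeRound v ≤ t) (E.IsCandidate v)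
      (E.peers (t + 1) v) (E.clustered t v) := by
  rw [peers_succ h, knowledge, state_succ h]
  simp only [nodeRound, headsAfter_eq h, input_estimate, round_eq h]
  rfl

open Classical in
theorem output_succ (h : E.Running t v) :
    (E.state (t + 1) v).output =
      if E.wakeRound v ≤ t ∧ AdjacencyClosed (E.knowledge (t + 1) v) then
        some (sInf {i | ∃ nbrs, .node i nbrs ∈ E.knowledge (t + 1) v}) else none := by
  rw [knowledge_succ h, peers_succ h, state_succ h]
  simp only [nodeRound, headsAfter_eq h, input_estimate, round_eq h]
  rfl

open Classical in
theorem message_succ (h : E.Running t v) (ha : E.graph.Adj v w) :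
    E.message (t + 1) v w = if E.id w ∈ E.peers (t + 1) v ∧ E.Sends t v then
      some (E.knowledge (t + 1) v) else none := by
  rw [message_succ_eq, if_pos ha, nodeStep_of_running h, Sends, knowledge_succ h, peers_succ h]
  simp only [nodeRound, headsAfter_eq h, input_estimate, round_eq h, ← not_le]
  rfl

theorem adj_of_message (h : E.message t v w = some K) : E.graph.Adj v w := by
  cases t with
  | zero => contradiction
  | succ t =>
    by_contra ha
    rw [message_succ_eq, if_neg ha] at h
    contradiction

theorem of_message_succ (h : E.message (t + 1) v w = some K) :
    E.Running t v ∧ E.id w ∈ E.peers (t + 1) v ∧ E.Sends t v ∧ K = E.knowledge (t + 1) v := by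
  have hr : E.Running t v := by
    by_contra hn
    rw [message_succ_of_not_running hn] at h
    contradiction
  rw [message_succ hr (adj_of_message h)] at h
  split_ifs at h with hc
  exact ⟨hr, hc.1, hc.2, (Option.some.inj h).symm⟩

theorem mem_peers_of_message (h : E.message t v w = some K) : E.id w ∈ E.peers t v := by
  cases t with
  | zero => contradiction
  | succ t => exact (of_message_succ h).2.1

theorem eq_knowledge_of_message (h : E.message t v w = some K) : K = E.knowledge t v := by
  cases t with
  | zero => contradiction
  | succ t => exact (of_message_succ h).2.2.2

theorem mem_received : f ∈ E.received t v ↔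
    f ∈ E.knowledge t v ∨ ∃ u K, E.message t u v = some K ∧ f ∈ K := by
  refine or_congr Iff.rfl ⟨?_, ?_⟩
  · rintro ⟨i, K, hK, hf⟩
    obtain ⟨u, -, -, hu⟩ := exists_message_of_inbox hK
    exact ⟨u, K, hu, hf⟩
  · rintro ⟨u, K, hK, hf⟩
    exact ⟨E.id u, K, (inbox_id (adj_of_message hK)).trans hK, hf⟩

theorem knowledge_subset_received (t : ℕ) (v : V) : E.knowledge t v ⊆ E.received t v :=
  Set.subset_union_left

theorem received_subset_clustered (t : ℕ) (v : V) : E.received t v ⊆ E.clustered t v :=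
  Set.subset_union_left

theorem clustered_subset_knowledge_succ (h : E.Running t v) :
    E.clustered t v ⊆ E.knowledge (t + 1) v := by
  rw [knowledge_succ h]
  exact fun _ hf => Or.inl hf

theorem received_subset_knowledge_succ (h : E.Running t v) :
    E.received t v ⊆ E.knowledge (t + 1) v :=
  (received_subset_clustered t v).trans (clustered_subset_knowledge_succ h)

theorem knowledge_subset_succ (t : ℕ) (v : V) : E.knowledge t v ⊆ E.knowledge (t + 1) v := by
  by_cases h : E.Running t v
  · exact (knowledge_subset_received t v).trans (received_subset_knowledge_succ h)
  · rw [knowledge, knowledge, state_succ_of_not_running h]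

theorem knowledge_mono (h : t ≤ t') (v : V) : E.knowledge t v ⊆ E.knowledge t' v :=
  monotone_nat_of_le_succ (f := (E.knowledge · v)) (knowledge_subset_succ · v) h

theorem mem_peers_succ (h : E.Running t v) : i ∈ E.peers (t + 1) v ↔ i ∈ E.peers t v ∨
    (∃ u K, E.id u = i ∧ E.message t u v = some K) ∨
      i ∈ (E.state t v).contacts (E.clustered t v) := by
  rw [peers_succ h, NodeState.newPeers, Set.union_assoc]
  refine or_congr Iff.rfl (or_congr ⟨?_, ?_⟩ Iff.rfl)
  · intro hi
    obtain ⟨K, hK⟩ := Option.isSome_iff_exists.1 hi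
    obtain ⟨u, -, hu, hu'⟩ := exists_message_of_inbox hK
    exact ⟨u, K, hu, hu'⟩
  · rintro ⟨u, K, rfl, hK⟩
    exact Option.isSome_iff_exists.2 ⟨K, (inbox_id (adj_of_message hK)).trans hK⟩

theorem peers_subset_succ (t : ℕ) (v : V) : E.peers t v ⊆ E.peers (t + 1) v := by
  by_cases h : E.Running t v
  · exact fun i hi => (mem_peers_succ h).2 (Or.inl hi)
  · rw [peers, peers, state_succ_of_not_running h]

theorem peers_mono (h : t ≤ t') (v : V) : E.peers t v ⊆ E.peers t' v :=
  monotone_nat_of_le_succ (f := (E.peers · v)) (peers_subset_succ · v) h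

theorem mem_contacts (h : E.Running t v) :
    i ∈ (E.state t v).contacts (E.clustered t v) ↔ i ∈ E.nbrIds v ∧ ∃ c q,
      .member (E.id v) (E.nbrIds v) c q ∈ E.clustered t v ∧ t + 1 = (q + 1) ^ 2 ∧
      ∀ j nbrs q', .member j nbrs c q' ∈ E.clustered t v →
        j ≠ i ∧ (i ∈ nbrs → q < q' ∨ q = q' ∧ E.id v ≤ j) := by
  simp only [NodeState.contacts, Set.mem_ofPred_eq, input_id, input_nbrIds, round_eq h]

theorem exists_adj_of_mem_peers (h : i ∈ E.peers t v) : ∃ w, E.graph.Adj v w ∧ E.id w = i := by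
  induction t with
  | zero => contradiction
  | succ t ih =>
    by_cases hr : E.Running t v
    · rcases (mem_peers_succ hr).1 h with h | ⟨u, K, hu, hK⟩ | h
      · exact ih h
      · exact ⟨u, (adj_of_message hK).symm, hu⟩
      · exact mem_nbrIds.1 ((mem_contacts hr).1 h).1
    · rw [peers, state_succ_of_not_running hr] at h
      exact ih h

theorem adj_of_mem_peers (h : E.id w ∈ E.peers t v) : E.graph.Adj v w := by
  obtain ⟨u, hu, huw⟩ := exists_adj_of_mem_peers h
  rwa [← id_inj.1 huw]

theorem owner_of_mem_joined (h : f ∈ E.joined t v) : f.owner = E.id v := by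
  rw [joined, NodeState.joinFacts] at h
  split_ifs at h
  · contradiction
  · exact (congrArg LocalFact.owner h).trans (input_id t v)
  · exact (congrArg LocalFact.owner h).trans (input_id t v)
  · contradiction

theorem mem_received_or_owner (h : f ∈ E.knowledge (t + 1) v) :
    f ∈ E.received t v ∨ f.owner = E.id v := by
  by_cases hr : E.Running t v
  · rw [knowledge_succ hr] at h
    rcases h with (h | h) | ⟨-, x, rfl, -⟩ | ⟨-, x, rfl, -⟩
    · exact Or.inl h
    · exact Or.inr (owner_of_mem_joined h)
    · exact Or.inr (input_id t v)
    · exact Or.inr (input_id t v)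
  · rw [knowledge, state_succ_of_not_running hr] at h
    exact Or.inl (knowledge_subset_received t v h)

theorem exists_owner_knows (h : f ∈ E.knowledge t v) :
    ∃ u, E.id u = f.owner ∧ f ∈ E.knowledge t u := by
  induction t generalizing v with
  | zero =>
    rw [knowledge_zero] at h
    exact ⟨v, (congrArg LocalFact.owner h).symm, h⟩
  | succ t ih =>
    rcases mem_received_or_owner h with hf | hf
    · obtain ⟨u, hu⟩ : ∃ u, f ∈ E.knowledge t u := by
        rcases mem_received.1 hf with hf | ⟨u, K, hK, hf⟩
        · exact ⟨v, hf⟩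
        · exact ⟨u, eq_knowledge_of_message hK ▸ hf⟩
      obtain ⟨w, hw, hf⟩ := ih hu
      exact ⟨w, hw, knowledge_subset_succ t w hf⟩
    · exact ⟨v, hf.symm, h⟩

theorem owner_knows (h : f ∈ E.knowledge t v) (hw : f.owner = E.id w) : f ∈ E.knowledge t w := by
  obtain ⟨u, hu, hf⟩ := exists_owner_knows h
  rwa [id_inj.1 (hu.trans hw)] at hf

theorem owner_knows_of_received (h : f ∈ E.received t v) (hw : f.owner = E.id w) :
    f ∈ E.knowledge t w := by
  rcases mem_received.1 h with h | ⟨u, K, hK, hf⟩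
  · exact owner_knows h hw
  · exact owner_knows (eq_knowledge_of_message hK ▸ hf) hw

theorem message_of_sends (hv : E.Running t v) (hp : E.id w ∈ E.peers (t + 1) v)
    (hs : E.Sends t v) : E.message (t + 1) v w = some (E.knowledge (t + 1) v) := by
  rw [message_succ hv (adj_of_mem_peers hp), if_pos ⟨hp, hs⟩]

theorem knowledge_subset_received_of_message (h : E.message t v w = some K) :
    E.knowledge t v ⊆ E.received t w := fun _ hf =>
  mem_received.2 (Or.inr ⟨v, K, h, eq_knowledge_of_message h ▸ hf⟩)

theorem mem_peers_succ_of_message (hw : E.Running t w) (h : E.message t v w = some K) :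
    E.id v ∈ E.peers (t + 1) w :=
  (mem_peers_succ hw).2 (Or.inr (Or.inl ⟨v, K, rfl, h⟩))

theorem running_of_le_wakeRound (h : t ≤ E.wakeRound v) : E.Running t v := by
  induction t with
  | zero => exact running_zero v
  | succ t ih =>
    rw [Running, output_succ (ih (Nat.le_of_succ_le h)), if_neg]
    exact fun hw => absurd hw.1 (Nat.not_le_of_lt h)

theorem running_of_le_firstWake (h : t ≤ E.firstWake) (v : V) : E.Running t v :=
  running_of_le_wakeRound (h.trans (E.firstWake_le v))

theorem sends_of_lt_firstWake (ht : t < E.firstWake) (v : V) : E.Sends t v :=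
  Or.inl (ht.trans_le (E.firstWake_le v))

theorem knowledge_succ_of_lt_firstWake (h : t < E.firstWake) (v : V) :
    E.knowledge (t + 1) v = E.clustered t v := by
  have : ¬ E.wakeRound v ≤ t := not_le.2 (h.trans_le (E.firstWake_le v))
  rw [knowledge_succ (running_of_le_firstWake h.le v)]
  simp only [NodeState.waved, this, false_and, or_false, Set.ofPred_mem_eq]

theorem message_of_mem_peers (ht₀ : 0 < t) (ht : t ≤ E.firstWake) (hp : E.id w ∈ E.peers t v) :
    E.message t v w = some (E.knowledge t v) := by
  obtain ⟨s, rfl⟩ := Nat.exists_eq_add_one_of_ne_zero ht₀.ne'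
  exact message_of_sends (running_of_le_firstWake (by omega) v) hp
    (sends_of_lt_firstWake (by omega) v)

theorem knowledge_subset_of_mem_peers (ht₀ : 0 < t) (ht : t < E.firstWake)
    (hp : E.id w ∈ E.peers t v) : E.knowledge t v ⊆ E.knowledge (t + 1) w :=
  (knowledge_subset_received_of_message (message_of_mem_peers ht₀ ht.le hp)).trans
    (received_subset_knowledge_succ (running_of_le_firstWake ht.le w))

theorem mem_peers_succ_comm (ht₀ : 0 < t) (ht : t < E.firstWake) (hp : E.id w ∈ E.peers t v) :
    E.id v ∈ E.peers (t + 1) w :=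
  mem_peers_succ_of_message (running_of_le_firstWake ht.le w) (message_of_mem_peers ht₀ ht.le hp)

end Execution

namespace Execution

variable {V : Type u} [Fintype V] {E : Execution V} {t t' : ℕ} {u v w x y : V}
  {nbrs : Finset ℕ} {i c c' q : ℕ} {f f' : LocalFact}

/-! ### The phases in which nodes join clusters -/

/-- The phase in which a node joins a cluster. -/
noncomputable def joinPhase (E : Execution V) (v : V) : ℕ := shiftedDist E.graph E.startPhase v

theorem joinPhase_le_startPhase (v : V) : E.joinPhase v ≤ E.startPhase v := shiftedDist_le_self v

theorem joinPhase_le_add_one (h : E.graph.Adj v w) : E.joinPhase w ≤ E.joinPhase v + 1 :=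
  shiftedDist_le_add_one E.connected h

theorem joinPhase_sq_lt_firstWake (v : V) : (E.joinPhase v + 1) ^ 2 < E.firstWake :=
  (Nat.pow_le_pow_left (Nat.succ_le_succ (joinPhase_le_startPhase v)) 2).trans_lt
    (E.startPhase_lt v)

theorem mem_joined_cases (hr : E.Running t v) (h : f ∈ E.joined t v) :
    (∃ u K nbrs c q, E.message t u v = some K ∧ .member (E.id u) nbrs c q ∈ K ∧
      f = .member (E.id v) (E.nbrIds v) c (q + 1)) ∨
    (t = E.startPhase v ^ 2 ∧ f = .member (E.id v) (E.nbrIds v) (E.id v) (E.startPhase v)) := by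
  rw [joined, NodeState.joinFacts, input_id, input_nbrIds, round_eq hr] at h
  split_ifs at h with hmember hsender hstart
  · contradiction
  · obtain ⟨i, K, nbrs, hK, hf⟩ := hsender.choose_spec
    obtain ⟨u, -, rfl, hu⟩ := exists_message_of_inbox hK
    exact Or.inl ⟨u, K, nbrs, _, _, hu, hf, h⟩
  · exact Or.inr ⟨hstart, h⟩
  · contradiction

theorem member_notMem_of_mem_joined (h : f ∈ E.joined t v) :
    .member (E.id v) nbrs c q ∉ E.knowledge t v := by
  rw [joined, NodeState.joinFacts, input_id] at h
  split_ifs at h with hmember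
  · contradiction
  all_goals exact fun hm => hmember ⟨nbrs, c, q, knowledge_subset_received t v hm⟩

theorem joined_subsingleton (h : f ∈ E.joined t v) (h' : f' ∈ E.joined t v) : f = f' := by
  rw [joined, NodeState.joinFacts] at h h'
  split_ifs at h h'
  · contradiction
  · exact h.trans h'.symm
  · exact h.trans h'.symm
  · contradiction

theorem exists_mem_joined (hr : E.Running t v)
    (hv : ∀ nbrs c q, .member (E.id v) nbrs c q ∉ E.knowledge t v)
    (h : t = E.startPhase v ^ 2 ∨
      ∃ u K nbrs c q, E.message t u v = some K ∧ .member (E.id u) nbrs c q ∈ K) :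
    ∃ c q, .member (E.id v) (E.nbrIds v) c q ∈ E.joined t v := by
  have hnew : ¬ ∃ nbrs c q, .member (E.id v) nbrs c q ∈ (E.state t v).received (E.inbox t v) :=
    fun ⟨nbrs, c, q, hm⟩ => hv nbrs c q (owner_knows_of_received hm rfl)
  rw [joined, NodeState.joinFacts, input_id, input_nbrIds, round_eq hr, if_neg hnew]
  split_ifs with hsender hstart
  · exact ⟨_, _, rfl⟩
  · exact ⟨_, _, rfl⟩
  · rcases h with h | ⟨u, K, nbrs, c, q, hK, hf⟩
    · exact absurd h hstart
    · exact absurd ⟨(c, q), E.id u, K, nbrs, (inbox_id (adj_of_message hK)).trans hK, hf⟩ hsender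

theorem member_knowledge_succ (ht : t < E.firstWake)
    (h : .member (E.id v) nbrs c q ∈ E.knowledge (t + 1) v) :
    .member (E.id v) nbrs c q ∈ E.knowledge t v ∨ .member (E.id v) nbrs c q ∈ E.joined t v := by
  rw [knowledge_succ_of_lt_firstWake ht] at h
  exact h.imp_left fun h => owner_knows_of_received h rfl

/-- The node `v` has joined the cluster with centre `c` before round `t`. -/
def InCluster (E : Execution V) (t : ℕ) (v : V) (c : ℕ) : Prop :=
  .member (E.id v) (E.nbrIds v) c (E.joinPhase v) ∈ E.knowledge t v

theorem InCluster.mono (h : t ≤ t') (hv : E.InCluster t v c) : E.InCluster t' v c :=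
  knowledge_mono h v hv

/-- The node `w` has joined the cluster with centre `c` just before `v`, and by contacting `v` it
has drawn `v` into this cluster. -/
structure IsParent (E : Execution V) (t : ℕ) (w v : V) (c : ℕ) : Prop where
  joinPhase_add_one : E.joinPhase w + 1 = E.joinPhase v
  inCluster : E.InCluster t w c
  mem_peers : E.id v ∈ E.peers (E.joinPhase v ^ 2) w
  mem_peers_symm : E.id w ∈ E.peers (E.joinPhase v ^ 2 + 1) v

theorem IsParent.mono (h : t ≤ t') (hw : E.IsParent t w v c) : E.IsParent t' w v c :=
  ⟨hw.1, hw.2.mono h, hw.3, hw.4⟩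

/-- The node `v` is the centre of its cluster. -/
def IsCentre (E : Execution V) (v : V) (c : ℕ) : Prop :=
  c = E.id v ∧ E.joinPhase v = E.startPhase v

/-- What holds before round `t` as long as nobody is awake: clusters grow by one layer per phase,
at the beginning of the phase. -/
structure PhaseInvariant (E : Execution V) (t : ℕ) : Prop where
  inCluster_iff : ∀ v, (∃ c, E.InCluster t v c) ↔ E.joinPhase v ^ 2 < t
  eq_of_member : ∀ v nbrs c q, .member (E.id v) nbrs c q ∈ E.knowledge t v →
    nbrs = E.nbrIds v ∧ q = E.joinPhase v
  unique : ∀ v c c', E.InCluster t v c → E.InCluster t v c' → c = c'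
  peer : ∀ u x, E.id x ∈ E.peers t u → E.joinPhase u ^ 2 < t ∧ E.joinPhase x ^ 2 ≤ t ∧
    (E.joinPhase x ^ 2 = t → E.joinPhase u + 1 = E.joinPhase x)
  origin : ∀ v c, E.InCluster t v c → E.IsCentre v c ∨ ∃ w, E.IsParent t w v c

namespace PhaseInvariant

theorem zero : E.PhaseInvariant 0 where
  inCluster_iff v := by simp [InCluster, knowledge_zero]
  eq_of_member v nbrs c q h := by simp [knowledge_zero] at h
  unique v c c' h := by simp [InCluster, knowledge_zero] at h
  peer u x h := by simp [peers_zero] at h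
  origin v c h := by simp [InCluster, knowledge_zero] at h

theorem exists_inCluster_of_member (I : E.PhaseInvariant t)
    (h : .member i nbrs c q ∈ E.knowledge t v) :
    ∃ u, E.id u = i ∧ nbrs = E.nbrIds u ∧ q = E.joinPhase u ∧ E.InCluster t u c := by
  obtain ⟨u, rfl, hm⟩ := exists_owner_knows h
  obtain ⟨rfl, rfl⟩ := I.eq_of_member u nbrs c q hm
  exact ⟨u, rfl, rfl, rfl, hm⟩

/-- The node with the smallest identifier among the first members adjacent to `x` has no reason to
leave the contact to another member, whatever it knows about the cluster. -/
theorem exists_contact (I : E.PhaseInvariant t) (ht : t ≤ E.firstWake) (hy : E.InCluster t y c)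
    (hty : t = (E.joinPhase y + 1) ^ 2) (hyx : E.graph.Adj y x) (hx : ¬ E.InCluster t x c)
    (hmin : ∀ u, E.InCluster t u c → E.graph.Adj u x → E.joinPhase y ≤ E.joinPhase u) :
    ∃ w, E.InCluster t w c ∧ E.joinPhase w = E.joinPhase y ∧ E.id x ∈ E.peers t w := by
  classical
  obtain ⟨s, rfl⟩ : ∃ s, t = s + 1 := Nat.exists_eq_succ_of_ne_zero (by rw [hty]; positivity)
  obtain ⟨w, hw, hwmin⟩ := Finset.exists_min_image (Finset.univ.filter fun w =>
    E.InCluster (s + 1) w c ∧ E.joinPhase w = E.joinPhase y ∧ E.graph.Adj w x) E.id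
    ⟨y, by simp [hy, hyx]⟩
  simp only [Finset.mem_filter, Finset.mem_univ, true_and] at hw hwmin
  obtain ⟨hwc, hwy, hwx⟩ := hw
  have hr : E.Running s w := running_of_le_firstWake (by omega) w
  refine ⟨w, hwc, hwy, (mem_peers_succ hr).2 (Or.inr (Or.inr ((mem_contacts hr).2 ?_)))⟩
  rw [← knowledge_succ_of_lt_firstWake (by omega)]
  refine ⟨id_mem_nbrIds.2 hwx, c, E.joinPhase w, hwc, by rw [hwy]; exact hty, fun i nbrs q hm => ?_⟩
  obtain ⟨u, rfl, rfl, rfl, hu⟩ := I.exists_inCluster_of_member hm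
  refine ⟨fun h => hx (id_inj.1 h ▸ hu), fun hux => ?_⟩
  rw [id_mem_nbrIds] at hux
  rcases (hmin u hu hux).lt_or_eq with h | h
  · exact Or.inl (hwy ▸ h)
  · exact Or.inr ⟨hwy.trans h, hwmin u ⟨hu, h.symm, hux⟩⟩

theorem le_joinPhase_sq_of_mem_joined (I : E.PhaseInvariant t) (h : f ∈ E.joined t v) :
    t ≤ E.joinPhase v ^ 2 := by
  by_contra! hlt
  obtain ⟨c, hc⟩ := (I.inCluster_iff v).2 hlt
  exact member_notMem_of_mem_joined h hc

theorem of_mem_joined (I : E.PhaseInvariant t) (hr : E.Running t v) (h : f ∈ E.joined t v) :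
    t = E.joinPhase v ^ 2 ∧ ∃ c, f = .member (E.id v) (E.nbrIds v) c (E.joinPhase v) ∧
      (E.IsCentre v c ∨ ∃ w, E.IsParent t w v c) := by
  have hle := I.le_joinPhase_sq_of_mem_joined h
  rcases mem_joined_cases hr h with ⟨u, K, nbrs, c, q, hK, hm, rfl⟩ | ⟨ht, rfl⟩
  · have hp := mem_peers_of_message hK
    obtain rfl := eq_knowledge_of_message hK
    obtain ⟨-, hge, hphase⟩ := I.peer u v hp
    obtain rfl : t = E.joinPhase v ^ 2 := hle.antisymm hge
    obtain ⟨rfl, rfl⟩ := I.eq_of_member u nbrs c q hm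
    exact ⟨rfl, c, by rw [hphase rfl], Or.inr ⟨u, hphase rfl, hm, hp,
      mem_peers_succ_of_message hr hK⟩⟩
  · have hs : E.joinPhase v = E.startPhase v := (joinPhase_le_startPhase v).antisymm
      (Nat.pow_le_pow_iff_left two_ne_zero |>.1 (ht ▸ hle))
    exact ⟨hs ▸ ht, E.id v, by rw [hs], Or.inl ⟨rfl, hs⟩⟩

section Succ

variable (I : E.PhaseInvariant t) (ht : t < E.firstWake)
include I ht

theorem eq_of_member_succ (h : .member (E.id v) nbrs c q ∈ E.knowledge (t + 1) v) :
    (nbrs = E.nbrIds v ∧ q = E.joinPhase v) ∧ E.joinPhase v ^ 2 < t + 1 := by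
  rcases member_knowledge_succ ht h with h | h
  · obtain ⟨rfl, rfl⟩ := I.eq_of_member v nbrs c q h
    exact ⟨⟨rfl, rfl⟩, ((I.inCluster_iff v).1 ⟨c, h⟩).trans t.lt_succ_self⟩
  · obtain ⟨hphase, c', hf, -⟩ := I.of_mem_joined (running_of_le_firstWake ht.le v) h
    cases hf
    exact ⟨⟨rfl, rfl⟩, by omega⟩

theorem exists_message_of_adj (hyx : E.graph.Adj y x) (hphase : E.joinPhase y + 1 = E.joinPhase x)
    (htx : t = E.joinPhase x ^ 2) (hx : ∀ c, ¬ E.InCluster t x c) :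
    ∃ w K nbrs c q, E.message t w x = some K ∧ .member (E.id w) nbrs c q ∈ K := by
  have hty : t = (E.joinPhase y + 1) ^ 2 := by rw [hphase, htx]
  obtain ⟨c, hc⟩ := (I.inCluster_iff y).2
    (by rw [hty]; exact Nat.pow_lt_pow_left (Nat.lt_succ_self _) two_ne_zero)
  have hmin : ∀ u, E.InCluster t u c → E.graph.Adj u x → E.joinPhase y ≤ E.joinPhase u :=
    fun u _ hu => by have := joinPhase_le_add_one hu; omega
  obtain ⟨w, hwc, -, hp⟩ := I.exists_contact ht.le hc hty hyx (hx c) hmin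
  exact ⟨w, _, _, _, _, message_of_mem_peers (by rw [hty]; positivity) ht.le hp, hwc⟩

theorem exists_inCluster_succ (hv : t = E.joinPhase v ^ 2) : ∃ c, E.InCluster (t + 1) v c := by
  have hnone : ∀ nbrs c q, .member (E.id v) nbrs c q ∉ E.knowledge t v := by
    intro nbrs c q hm
    obtain ⟨rfl, rfl⟩ := I.eq_of_member v nbrs c q hm
    exact hv.not_gt ((I.inCluster_iff v).1 ⟨c, hm⟩)
  obtain ⟨c, q, hc⟩ : ∃ c q, .member (E.id v) (E.nbrIds v) c q ∈ E.joined t v := by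
    refine exists_mem_joined (running_of_le_firstWake ht.le v) hnone ?_
    rcases shiftedDist_eq_self_or_exists_adj E.connected v with h | ⟨y, hyv, hy⟩
    · exact Or.inl (hv.trans (congrArg (· ^ 2) h))
    · exact Or.inr (I.exists_message_of_adj ht hyv hy hv fun c => hnone _ _ _)
  have hk : .member (E.id v) (E.nbrIds v) c q ∈ E.knowledge (t + 1) v := by
    rw [knowledge_succ_of_lt_firstWake ht]; exact Or.inr hc
  obtain ⟨⟨-, rfl⟩, -⟩ := I.eq_of_member_succ ht hk
  exact ⟨c, hk⟩

theorem unique_succ (h : E.InCluster (t + 1) v c) (h' : E.InCluster (t + 1) v c') : c = c' := by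
  rcases member_knowledge_succ ht h with h | h <;> rcases member_knowledge_succ ht h' with h' | h'
  · exact I.unique v c c' h h'
  · exact absurd h (member_notMem_of_mem_joined h')
  · exact absurd h' (member_notMem_of_mem_joined h)
  · simpa using joined_subsingleton h h'

theorem peer_succ (hx : E.id x ∈ E.peers (t + 1) u) :
    E.joinPhase u ^ 2 < t + 1 ∧ E.joinPhase x ^ 2 ≤ t + 1 ∧
      (E.joinPhase x ^ 2 = t + 1 → E.joinPhase u + 1 = E.joinPhase x) := by
  have hr := running_of_le_firstWake ht.le u
  rcases (mem_peers_succ hr).1 hx with hx | ⟨y, K, hy, hK⟩ | hx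
  · obtain ⟨hu, hx, -⟩ := I.peer u x hx
    exact ⟨by omega, by omega, by omega⟩
  · obtain rfl := id_inj.1 hy
    obtain ⟨hx, hu, -⟩ := I.peer y u (mem_peers_of_message hK)
    exact ⟨by omega, by omega, by omega⟩
  · obtain ⟨hux, c, q, hm, hq, -⟩ := (mem_contacts hr).1 hx
    rw [← knowledge_succ_of_lt_firstWake ht] at hm
    obtain ⟨⟨-, rfl⟩, hlt⟩ := I.eq_of_member_succ ht hm
    have hle := joinPhase_le_add_one (id_mem_nbrIds.1 hux)
    exact ⟨hlt, hq ▸ Nat.pow_le_pow_left hle 2,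
      fun h => Nat.pow_left_injective two_ne_zero (hq.symm.trans h.symm)⟩

theorem origin_succ (h : E.InCluster (t + 1) v c) :
    E.IsCentre v c ∨ ∃ w, E.IsParent (t + 1) w v c := by
  have hmono : (∃ w, E.IsParent t w v c) → ∃ w, E.IsParent (t + 1) w v c :=
    fun ⟨w, hw⟩ => ⟨w, hw.mono t.le_succ⟩
  rcases member_knowledge_succ ht h with h | h
  · exact (I.origin v c h).imp_right hmono
  · obtain ⟨-, c', hf, horigin⟩ := I.of_mem_joined (running_of_le_firstWake ht.le v) h
    cases hf
    exact horigin.imp_right hmono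

theorem succ : E.PhaseInvariant (t + 1) where
  inCluster_iff v := by
    refine ⟨fun ⟨c, hc⟩ => (I.eq_of_member_succ ht hc).2, fun h => ?_⟩
    rcases (Nat.lt_succ_iff.1 h).lt_or_eq with hlt | heq
    · obtain ⟨c, hc⟩ := (I.inCluster_iff v).2 hlt
      exact ⟨c, hc.mono t.le_succ⟩
    · exact I.exists_inCluster_succ ht heq.symm
  eq_of_member _ _ _ _ h := (I.eq_of_member_succ ht h).1
  unique _ _ _ := I.unique_succ ht
  peer _ _ := I.peer_succ ht
  origin _ _ := I.origin_succ ht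

end Succ

end PhaseInvariant

theorem phaseInvariant (ht : t ≤ E.firstWake) : E.PhaseInvariant t := by
  induction t with
  | zero => exact .zero
  | succ t ih => exact (ih (by omega)).succ (by omega)

end Execution

namespace Execution

variable {V : Type u} [Fintype V] {E : Execution V} {t : ℕ} {u u' v w x y z : V} {i c : ℕ}

/-! ### Clusters and the spanner -/

theorem joinPhase_sq_lt (v : V) : E.joinPhase v ^ 2 < (E.joinPhase v + 1) ^ 2 :=
  Nat.pow_lt_pow_left (Nat.lt_succ_self _) two_ne_zero

theorem exists_inCluster (v : V) : ∃ c, E.InCluster E.firstWake v c :=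
  ((phaseInvariant le_rfl).inCluster_iff v).2
    ((joinPhase_sq_lt v).trans (joinPhase_sq_lt_firstWake v))

/-- The identifier of the centre of the cluster of a node. -/
noncomputable def clusterId (E : Execution V) (v : V) : ℕ := (exists_inCluster (E := E) v).choose

theorem inCluster_firstWake (v : V) : E.InCluster E.firstWake v (E.clusterId v) :=
  (exists_inCluster v).choose_spec

theorem InCluster.eq_clusterId (ht : t ≤ E.firstWake) (h : E.InCluster t v c) :
    c = E.clusterId v :=
  (phaseInvariant le_rfl).unique v _ _ (h.mono ht) (inCluster_firstWake v)

theorem inCluster_clusterId (ht : t ≤ E.firstWake) (h : E.joinPhase v ^ 2 < t) :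
    E.InCluster t v (E.clusterId v) := by
  obtain ⟨c, hc⟩ := ((phaseInvariant ht).inCluster_iff v).2 h
  rwa [← hc.eq_clusterId ht]

/-- At the end of round `t` the node `u` contacts the node `x` outside its cluster. -/
def Contacts (E : Execution V) (t : ℕ) (u x : V) : Prop :=
  E.id x ∈ (E.state t u).contacts (E.clustered t u)

theorem Contacts.mem_peers (h : E.Contacts t u x) (ht : t ≤ E.firstWake) :
    E.id x ∈ E.peers (t + 1) u :=
  (mem_peers_succ (running_of_le_firstWake ht u)).2 (Or.inr (Or.inr h))

theorem Contacts.spec (h : E.Contacts t u x) (ht : t < E.firstWake) :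
    E.graph.Adj u x ∧ t + 1 = (E.joinPhase u + 1) ^ 2 ∧
      ∀ i nbrs q, .member i nbrs (E.clusterId u) q ∈ E.knowledge (t + 1) u → E.id x ∈ nbrs →
        E.joinPhase u < q ∨ E.joinPhase u = q ∧ E.id u ≤ i := by
  obtain ⟨hux, c, q, hm, hq, hfirst⟩ := (mem_contacts (running_of_le_firstWake ht.le u)).1 h
  rw [← knowledge_succ_of_lt_firstWake ht] at hm hfirst
  obtain ⟨-, rfl⟩ := (phaseInvariant ht).eq_of_member u _ _ _ hm
  obtain rfl : c = E.clusterId u := InCluster.eq_clusterId ht hm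
  exact ⟨id_mem_nbrIds.1 hux, hq, fun i nbrs q hk => (hfirst i nbrs q hk).2⟩

theorem exists_contacts_of_mem_peers (ht : t ≤ E.firstWake) (h : E.id x ∈ E.peers t u) :
    ∃ s < t, E.Contacts s u x ∨ E.Contacts s x u := by
  induction t generalizing u x with
  | zero => contradiction
  | succ t ih =>
    have ih' {u x : V} (h : E.id x ∈ E.peers t u) :
        ∃ s < t + 1, E.Contacts s u x ∨ E.Contacts s x u :=
      (ih (by omega) h).imp fun s hs => ⟨by omega, hs.2⟩
    rcases (mem_peers_succ (running_of_le_firstWake (by omega) u)).1 h with h | ⟨y, K, hy, hK⟩ | h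
    · exact ih' h
    · obtain rfl := id_inj.1 hy
      exact (ih' (mem_peers_of_message hK)).imp fun s hs => ⟨hs.1, hs.2.symm⟩
    · exact ⟨t, t.lt_succ_self, Or.inl h⟩

theorem mem_peers_firstWake_comm (h : E.id x ∈ E.peers E.firstWake u) :
    E.id u ∈ E.peers E.firstWake x := by
  obtain ⟨s, hs, hux | hxu⟩ := exists_contacts_of_mem_peers le_rfl h
  · have := (hux.spec hs).2.1
    have := joinPhase_sq_lt_firstWake (E := E) u
    exact peers_mono (by omega) _ (mem_peers_succ_comm s.succ_pos (by omega) (hux.mem_peers hs.le))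
  · exact peers_mono hs _ (hxu.mem_peers hs.le)

/-- The graph of the edges between peers at the time when the first node wakes up. -/
def spanner (E : Execution V) : SimpleGraph V where
  Adj u x := E.id x ∈ E.peers E.firstWake u
  symm := ⟨fun _ _ h => mem_peers_firstWake_comm h⟩
  loopless := ⟨fun u h => E.graph.loopless.irrefl u (adj_of_mem_peers h)⟩

/-- Passing from parent to parent leads from `v` to the centre `z` of its cluster. -/
inductive CentrePath (E : Execution V) : V → V → Prop
  | centre {v : V} (h : E.IsCentre v (E.clusterId v)) : CentrePath E v v
  | step {w v z : V} (hw : E.IsParent E.firstWake w v (E.clusterId v)) (h : CentrePath E w z) :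
      CentrePath E v z

theorem exists_centrePath (v : V) : ∃ z, E.CentrePath v z := by
  induction h : E.joinPhase v generalizing v with
  | zero =>
    rcases (phaseInvariant le_rfl).origin v _ (inCluster_firstWake v) with hv | ⟨w, hw⟩
    · exact ⟨v, .centre hv⟩
    · exact absurd hw.joinPhase_add_one (by omega)
  | succ k ih =>
    rcases (phaseInvariant le_rfl).origin v _ (inCluster_firstWake v) with hv | ⟨w, hw⟩
    · exact ⟨v, .centre hv⟩
    · obtain ⟨z, hz⟩ := ih w (by have := hw.joinPhase_add_one; omega)
      exact ⟨z, .step hw hz⟩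

namespace CentrePath

theorem id_eq (h : E.CentrePath v z) : E.id z = E.clusterId v := by
  induction h with
  | centre h => exact h.1.symm
  | step hw _ ih => exact ih.trans (hw.inCluster.eq_clusterId le_rfl).symm

theorem startPhase_add_dist_le (h : E.CentrePath v z) :
    E.startPhase z + E.graph.dist z v ≤ E.joinPhase v := by
  induction h with
  | centre h => rw [SimpleGraph.dist_self, add_zero, h.2]
  | @step w v z hw _ ih =>
    have := dist_le_dist_add_one_of_adj (G := E.graph) E.connected
      (adj_of_mem_peers hw.mem_peers) z
    have := hw.joinPhase_add_one
    omega

theorem exists_walk (h : E.CentrePath v z) :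
    ∃ p : E.spanner.Walk v z, p.length ≤ E.joinPhase v := by
  induction h with
  | centre => exact ⟨.nil, Nat.zero_le _⟩
  | @step w v z hw _ ih =>
    obtain ⟨p, hp⟩ := ih
    have hsq : E.joinPhase v ^ 2 + 1 ≤ E.firstWake :=
      (joinPhase_sq_lt v).trans (joinPhase_sq_lt_firstWake v)
    have hvw : E.spanner.Adj v w := peers_mono hsq v hw.mem_peers_symm
    exact ⟨.cons hvw p, by rw [SimpleGraph.Walk.length_cons, ← hw.joinPhase_add_one]; omega⟩

theorem knowledge_subset_centre (h : E.CentrePath v z) (ht : E.joinPhase v ^ 2 < t)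
    (htw : t + E.joinPhase v ≤ E.firstWake) :
    E.knowledge t v ⊆ E.knowledge (t + E.joinPhase v) z := by
  induction h generalizing t with
  | centre => exact knowledge_mono (Nat.le_add_right _ _) _
  | @step w v z hw _ ih =>
    have hphase := hw.joinPhase_add_one
    have hvw : E.knowledge t v ⊆ E.knowledge (t + 1) w :=
      knowledge_subset_of_mem_peers (by omega) (by omega) (peers_mono ht _ hw.mem_peers_symm)
    have hwz := ih (t := t + 1) (by have := joinPhase_sq_lt (E := E) w; rw [hphase] at this; omega)
      (by omega)
    rw [show t + E.joinPhase v = t + 1 + E.joinPhase w by omega]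
    exact hvw.trans hwz

theorem knowledge_centre_subset (h : E.CentrePath v z) (ht : E.joinPhase v ^ 2 < t)
    (htw : t + E.joinPhase v ≤ E.firstWake) :
    E.knowledge t z ⊆ E.knowledge (t + E.joinPhase v) v := by
  induction h with
  | centre => exact knowledge_mono (Nat.le_add_right _ _) _
  | @step w v z hw _ ih =>
    have hphase := hw.joinPhase_add_one
    have hzw := ih (by have := joinPhase_sq_lt (E := E) w; rw [hphase] at this; omega) (by omega)
    have hwv : E.knowledge (t + E.joinPhase w) w ⊆ E.knowledge (t + E.joinPhase w + 1) v :=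
      knowledge_subset_of_mem_peers (by omega) (by omega) (peers_mono (by omega) _ hw.mem_peers)
    rw [← hphase]
    exact hzw.trans hwv

end CentrePath

/-- The centre of the cluster of a node. -/
noncomputable def centre (E : Execution V) (v : V) : V := (exists_centrePath (E := E) v).choose

theorem centrePath (v : V) : E.CentrePath v (E.centre v) := (exists_centrePath v).choose_spec

theorem centre_eq_centre_iff : E.centre v = E.centre w ↔ E.clusterId v = E.clusterId w := by
  rw [← (centrePath v).id_eq, ← (centrePath w).id_eq, id_inj]

/-- A phase is long enough for a fact to travel from a member to the centre and from there to any
other member. -/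
theorem member_mem_knowledge (hc : E.clusterId w = E.clusterId u)
    (hphase : E.joinPhase w ≤ E.joinPhase u) :
    .member (E.id w) (E.nbrIds w) (E.clusterId u) (E.joinPhase w) ∈
      E.knowledge ((E.joinPhase u + 1) ^ 2) u := by
  have hwake := joinPhase_sq_lt_firstWake (E := E) u
  have hsq := Nat.pow_le_pow_left hphase 2
  have hlength : (E.joinPhase u + 1) ^ 2 = E.joinPhase u ^ 2 + 1 + 2 * E.joinPhase u := by ring
  have hw : E.InCluster (E.joinPhase u ^ 2 + 1) w (E.clusterId u) :=
    hc ▸ inCluster_clusterId (by omega) (by omega)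
  have hcentre := (centrePath w).knowledge_subset_centre (by omega) (by omega) hw
  rw [centre_eq_centre_iff.2 hc] at hcentre
  exact knowledge_mono (by omega) u
    ((centrePath u).knowledge_centre_subset (by omega) (by omega) hcentre)

/-- The node `u` is the node of its cluster that is entitled to contact its neighbour `x`: the
first one in the order by phase and identifier among the neighbours of `x`. -/
def IsFirstContact (E : Execution V) (u x : V) : Prop :=
  E.graph.Adj u x ∧ ∀ w, E.clusterId w = E.clusterId u → E.graph.Adj w x →
    E.joinPhase w ≤ E.joinPhase u → E.joinPhase u = E.joinPhase w ∧ E.id u ≤ E.id w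

theorem IsFirstContact.eq (h : E.IsFirstContact u x) (h' : E.IsFirstContact u' x)
    (hc : E.clusterId u = E.clusterId u') : u = u' := by
  wlog hphase : E.joinPhase u' ≤ E.joinPhase u generalizing u u'
  · exact (this h' h hc.symm (Nat.le_of_not_le hphase)).symm
  · obtain ⟨heq, hle⟩ := h.2 u' hc.symm h'.1 hphase
    exact id_inj.1 (hle.antisymm (h'.2 u hc h.1 heq.le).2)

theorem Contacts.isFirstContact (h : E.Contacts t u x) (ht : t < E.firstWake) :
    E.IsFirstContact u x := by
  obtain ⟨hux, hround, hfirst⟩ := h.spec ht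
  refine ⟨hux, fun w hw hwx hle => ?_⟩
  have hk := member_mem_knowledge hw hle
  rw [← hround] at hk
  exact (hfirst _ _ _ hk (id_mem_nbrIds.2 hwx)).resolve_left hle.not_gt

theorem isFirstContact_or_of_spanner_adj (h : E.spanner.Adj u x) :
    E.IsFirstContact u x ∨ E.IsFirstContact x u := by
  obtain ⟨s, hs, h⟩ := exists_contacts_of_mem_peers le_rfl h
  exact h.imp (·.isFirstContact hs) (·.isFirstContact hs)

open Classical in
/-- The nodes close enough to `x` to be the centre of a cluster that is adjacent to `x`. -/
noncomputable def nearCentres (E : Execution V) (x : V) : Finset V :=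
  Finset.univ.filter fun z => E.startPhase z + E.graph.dist z x ≤ E.joinPhase x + 2

theorem mem_nearCentres : z ∈ E.nearCentres x ↔
    E.startPhase z + E.graph.dist z x ≤ E.joinPhase x + 2 := by
  simp only [nearCentres, Finset.mem_filter, Finset.mem_univ, true_and]

theorem IsFirstContact.centre_mem_nearCentres (h : E.IsFirstContact u x) :
    E.centre u ∈ E.nearCentres x := by
  have := dist_le_dist_add_one_of_adj (G := E.graph) E.connected h.1 (E.centre u)
  have := (centrePath (E := E) u).startPhase_add_dist_le
  have := joinPhase_le_add_one h.1.symm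
  rw [mem_nearCentres]
  omega

open Classical in
theorem card_isFirstContact_le (x : V) :
    (Finset.univ.filter (E.IsFirstContact · x)).card ≤ (E.nearCentres x).card := by
  refine Finset.card_le_card_of_injOn E.centre (fun u hu => ?_) (fun u hu u' hu' h => ?_)
  · exact (Finset.mem_filter.1 hu).2.centre_mem_nearCentres
  · exact (Finset.mem_filter.1 hu).2.eq (Finset.mem_filter.1 hu').2 (centre_eq_centre_iff.1 h)

open Classical in
/-- The pairs of nodes that are adjacent in the spanner. -/
noncomputable def spannerPairs (E : Execution V) : Finset (V × V) :=
  Finset.univ.filter fun e => E.spanner.Adj e.1 e.2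

open Classical in
theorem card_spannerPairs_le {R : ℕ} (hR : ∀ x, (E.nearCentres x).card ≤ R) :
    E.spannerPairs.card ≤ 2 * (Fintype.card V * R) := by
  have hsum : ∑ x, (Finset.univ.filter (E.IsFirstContact · x)).card ≤ Fintype.card V * R := by
    rw [← Finset.card_univ, ← smul_eq_mul]
    exact Finset.sum_le_card_nsmul _ _ _ fun x _ => (card_isFirstContact_le x).trans (hR x)
  have hin : (Finset.univ.filter fun e : V × V => E.IsFirstContact e.1 e.2).card ≤
      Fintype.card V * R := by
    simpa only [Finset.card_filter, Fintype.sum_prod_type_right] using hsum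
  have hout : (Finset.univ.filter fun e : V × V => E.IsFirstContact e.2 e.1).card ≤
      Fintype.card V * R := by
    simpa only [Finset.card_filter, Fintype.sum_prod_type] using hsum
  calc E.spannerPairs.card
      ≤ ((Finset.univ.filter fun e : V × V => E.IsFirstContact e.1 e.2) ∪
          Finset.univ.filter fun e : V × V => E.IsFirstContact e.2 e.1).card := by
        rw [← Finset.filter_or]
        exact Finset.card_le_card fun e he => Finset.mem_filter.2
          ⟨Finset.mem_univ e, isFirstContact_or_of_spanner_adj (Finset.mem_filter.1 he).2⟩
    _ ≤ Fintype.card V * R + Fintype.card V * R :=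
        (Finset.card_union_le _ _).trans (add_le_add hin hout)
    _ = 2 * (Fintype.card V * R) := (two_mul _).symm

theorem exists_clusterId_eq_and_spanner_adj (h : E.graph.Adj y x)
    (hc : E.clusterId y ≠ E.clusterId x) :
    ∃ w, E.clusterId y = E.clusterId w ∧ E.spanner.Adj w x := by
  classical
  obtain ⟨u, hu, hmin⟩ := Finset.exists_min_image (Finset.univ.filter fun u =>
    E.clusterId u = E.clusterId y ∧ E.graph.Adj u x) E.joinPhase ⟨y, by simp [h]⟩
  simp only [Finset.mem_filter, Finset.mem_univ, true_and] at hu hmin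
  have hwake := (joinPhase_sq_lt_firstWake (E := E) u).le
  have hcluster : E.InCluster ((E.joinPhase u + 1) ^ 2) u (E.clusterId y) :=
    hu.1 ▸ inCluster_clusterId hwake (joinPhase_sq_lt u)
  obtain ⟨w, hw, -, hp⟩ := (phaseInvariant hwake).exists_contact hwake hcluster rfl hu.2
    (fun hx => hc (hx.eq_clusterId hwake))
    (fun u' hu' ha => hmin u' ⟨(hu'.eq_clusterId hwake).symm, ha⟩)
  exact ⟨w, hw.eq_clusterId hwake, peers_mono hwake w hp⟩

section Stretch

variable {k : ℕ} (hk : ∀ v, E.startPhase v ≤ k)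
include hk

theorem exists_spanner_walk_of_clusterId_eq (h : E.clusterId v = E.clusterId w) :
    ∃ p : E.spanner.Walk v w, p.length ≤ 2 * k := by
  obtain ⟨p, hp⟩ : ∃ p : E.spanner.Walk v (E.centre w), p.length ≤ E.joinPhase v :=
    centre_eq_centre_iff.2 h ▸ (centrePath v).exists_walk
  obtain ⟨q, hq⟩ := (centrePath (E := E) w).exists_walk
  have := (joinPhase_le_startPhase v).trans (hk v)
  have := (joinPhase_le_startPhase w).trans (hk w)
  exact ⟨p.append q.reverse, by
    rw [SimpleGraph.Walk.length_append, SimpleGraph.Walk.length_reverse]; omega⟩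

theorem exists_spanner_walk_of_adj (h : E.graph.Adj y x) :
    ∃ p : E.spanner.Walk y x, p.length ≤ 2 * k + 1 := by
  by_cases hc : E.clusterId y = E.clusterId x
  · obtain ⟨p, hp⟩ := exists_spanner_walk_of_clusterId_eq hk hc
    exact ⟨p, by omega⟩
  · obtain ⟨w, hw, hwx⟩ := exists_clusterId_eq_and_spanner_adj h hc
    obtain ⟨p, hp⟩ := exists_spanner_walk_of_clusterId_eq hk hw
    exact ⟨p.append (.cons hwx .nil), by
      simpa only [SimpleGraph.Walk.length_append, SimpleGraph.Walk.length_cons,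
        SimpleGraph.Walk.length_nil, zero_add] using Nat.succ_le_succ hp⟩

theorem exists_spanner_walk (v w : V) :
    ∃ p : E.spanner.Walk v w, p.length ≤ (2 * k + 1) * E.graph.dist v w := by
  obtain ⟨q, hq⟩ := (E.connected v w).exists_walk_length_eq_dist
  rw [← hq]
  clear hq
  induction q with
  | nil => exact ⟨.nil, Nat.zero_le _⟩
  | cons h q ih =>
    obtain ⟨p, hp⟩ := exists_spanner_walk_of_adj hk h
    obtain ⟨p', hp'⟩ := ih
    refine ⟨p.append p', ?_⟩
    rw [SimpleGraph.Walk.length_append, SimpleGraph.Walk.length_cons]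
    linarith

end Stretch

theorem knowledge_and_peers_succ_of_not_running (h : ¬ E.Running t v) :
    E.knowledge (t + 1) v = E.knowledge t v ∧ E.peers (t + 1) v = E.peers t v := by
  rw [knowledge, peers, state_succ_of_not_running h]
  exact ⟨rfl, rfl⟩

theorem clustered_eq_received (ht : E.firstWake ≤ t) : E.clustered t v = E.received t v :=
  Set.union_eq_self_of_subset_right fun _ hf =>
    absurd ((inCluster_firstWake v).mono ht) (member_notMem_of_mem_joined hf)

theorem member_mem_knowledge_firstWake {nbrs : Finset ℕ} {q : ℕ} (ht : E.firstWake ≤ t)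
    (h : .member (E.id v) nbrs c q ∈ E.knowledge t v) :
    .member (E.id v) nbrs c q ∈ E.knowledge E.firstWake v := by
  induction t, ht using Nat.le_induction with
  | base => exact h
  | succ t ht ih =>
    by_cases hr : E.Running t v
    · rw [knowledge_succ hr, clustered_eq_received ht] at h
      rcases h with h | ⟨-, x, hx, -⟩ | ⟨-, x, hx, -⟩
      · exact ih (owner_knows_of_received h rfl)
      · cases hx
      · cases hx
    · exact ih ((knowledge_and_peers_succ_of_not_running hr).1 ▸ h)

theorem notMem_contacts (ht : E.firstWake ≤ t) (hr : E.Running t v) :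
    i ∉ (E.state t v).contacts (E.clustered t v) := by
  intro hi
  obtain ⟨-, c, q, hm, hq, -⟩ := (mem_contacts hr).1 hi
  rw [clustered_eq_received ht] at hm
  have hm := member_mem_knowledge_firstWake ht (owner_knows_of_received hm rfl)
  obtain ⟨-, rfl⟩ := (phaseInvariant le_rfl).eq_of_member v _ _ _ hm
  have := joinPhase_sq_lt_firstWake (E := E) v
  omega

theorem peers_eq_peers_firstWake (ht : E.firstWake ≤ t) (v : V) :
    E.peers t v = E.peers E.firstWake v := by
  induction t, ht using Nat.le_induction generalizing v with
  | base => rfl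
  | succ t ht ih =>
    by_cases hr : E.Running t v
    · refine Set.Subset.antisymm (fun i hi => ?_) (peers_mono (by omega) v)
      rcases (mem_peers_succ hr).1 hi with hi | ⟨u, K, rfl, hK⟩ | hi
      · exact ih v ▸ hi
      · exact mem_peers_firstWake_comm (ih u ▸ mem_peers_of_message hK)
      · exact absurd hi (notMem_contacts ht hr)
    · rw [(knowledge_and_peers_succ_of_not_running hr).2, ih]

theorem mem_peers_iff (ht : E.firstWake ≤ t) :
    i ∈ E.peers t v ↔ ∃ w, E.spanner.Adj v w ∧ E.id w = i := by
  rw [peers_eq_peers_firstWake ht]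
  refine ⟨fun h => ?_, fun ⟨_, h, hw⟩ => hw ▸ h⟩
  obtain ⟨w, -, rfl⟩ := exists_adj_of_mem_peers h
  exact ⟨w, h, rfl⟩

end Execution

/-- Facts about waves, as opposed to facts about the network and its clusters. -/
def LocalFact.IsWave : LocalFact → Prop
  | adopt _ _ _ => True
  | done _ _ => True
  | _ => False

namespace Execution

variable {V : Type u} [Fintype V] {E : Execution V} {t t' : ℕ} {v w z : V} {x r r' : ℕ}
  {f : LocalFact}

/-! ### Waves and echos -/

theorem Running.of_le (h : t ≤ t') (hv : E.Running t' v) : E.Running t v :=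
  Nat.decreasingInduction (motive := fun s _ => E.Running s v) (fun _ _ => Running.of_succ) hv h

theorem firstWake_le_wakeRound (v : V) : E.firstWake ≤ E.wakeRound v := E.firstWake_le v

theorem wakeRound_le_lastWake (v : V) : E.wakeRound v ≤ E.lastWake := E.le_lastWake v

theorem mem_adoptFacts (hr : E.Running t v) :
    f ∈ (E.state t v).adoptFacts (E.IsCandidate v) (E.peers (t + 1) v) (E.clustered t v) ↔
      ∃ x, f = .adopt (E.id v) x t ∧ (∀ r, .adopt (E.id v) x r ∉ E.clustered t v) ∧
        (x = E.id v ∧ E.IsCandidate v ∨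
          ∃ i ∈ E.peers (t + 1) v, ∃ r, .adopt i x r ∈ E.clustered t v) := by
  simp only [NodeState.adoptFacts, Set.mem_ofPred_eq, input_id, round_eq hr]

theorem mem_doneFacts :
    f ∈ (E.state t v).doneFacts (E.peers (t + 1) v) (E.adopted t v) ↔
      ∃ x, f = .done (E.id v) x ∧ ∃ r, .adopt (E.id v) x r ∈ E.adopted t v ∧
        ∀ i ∈ E.peers (t + 1) v, ∃ r', .adopt i x r' ∈ E.adopted t v ∧
          (r < r' → .done i x ∈ E.adopted t v) := by
  simp only [NodeState.doneFacts, Set.mem_ofPred_eq, input_id]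

theorem mem_knowledge_succ (hr : E.Running t v) : f ∈ E.knowledge (t + 1) v ↔
    f ∈ E.clustered t v ∨
      E.wakeRound v ≤ t ∧
        f ∈ (E.state t v).adoptFacts (E.IsCandidate v) (E.peers (t + 1) v) (E.clustered t v) ∨
      E.wakeRound v ≤ t ∧ f ∈ (E.state t v).doneFacts (E.peers (t + 1) v) (E.adopted t v) := by
  rw [knowledge_succ hr]
  rfl

theorem adopted_subset_knowledge_succ (hr : E.Running t v) (hw : E.wakeRound v ≤ t) :
    E.adopted t v ⊆ E.knowledge (t + 1) v := fun _ hf =>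
  (mem_knowledge_succ hr).2 (hf.imp_right fun hf => Or.inl ⟨hw, hf⟩)

theorem knowledge_subset_adopted (t : ℕ) (v : V) : E.knowledge t v ⊆ E.adopted t v :=
  ((knowledge_subset_received t v).trans (received_subset_clustered t v)).trans
    Set.subset_union_left

theorem mem_received_of_isWave (hr : E.Running t v) (hf : f.IsWave) (h : f ∈ E.clustered t v) :
    f ∈ E.received t v := by
  rcases h with h | h
  · exact h
  · rcases mem_joined_cases hr h with ⟨_, _, _, _, _, _, _, rfl⟩ | ⟨-, rfl⟩ <;> exact hf.elim

/-- In round `t` the node `v` adds to its knowledge the fact `f` on a wave. -/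
structure Creates (E : Execution V) (t : ℕ) (v : V) (f : LocalFact) : Prop where
  running : E.Running t v
  mem_knowledge : f ∈ E.knowledge (t + 1) v
  notMem_clustered : f ∉ E.clustered t v

namespace Creates

theorem cases (h : E.Creates t v f) : E.wakeRound v ≤ t ∧
    (f ∈ (E.state t v).adoptFacts (E.IsCandidate v) (E.peers (t + 1) v) (E.clustered t v) ∨
      f ∈ (E.state t v).doneFacts (E.peers (t + 1) v) (E.adopted t v)) := by
  rcases (mem_knowledge_succ h.running).1 h.mem_knowledge with hf | ⟨hw, hf⟩ | ⟨hw, hf⟩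
  · exact absurd hf h.notMem_clustered
  · exact ⟨hw, Or.inl hf⟩
  · exact ⟨hw, Or.inr hf⟩

theorem firstWake_le (h : E.Creates t v f) : E.firstWake ≤ t :=
  (firstWake_le_wakeRound v).trans h.cases.1

theorem eq (h : E.Creates t v f) (h' : E.Creates t' v f) : t = t' := by
  wlog hlt : t < t' generalizing t t'
  · exact (Nat.le_of_not_lt hlt).antisymm' <| Nat.le_of_not_lt fun hlt' => hlt'.ne (this h' h hlt')
  exact absurd (received_subset_clustered t' v
    (knowledge_subset_received t' v (knowledge_mono hlt v h.mem_knowledge))) h'.notMem_clustered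

end Creates

theorem exists_creates (hf : f.IsWave) (ho : f.owner = E.id v) (h : f ∈ E.knowledge t v) :
    ∃ s < t, E.Creates s v f := by
  induction t with
  | zero =>
    rw [knowledge_zero, Set.mem_singleton_iff] at h
    exact (h ▸ hf : (LocalFact.node _ _).IsWave).elim
  | succ t ih =>
    by_cases hold : f ∈ E.knowledge t v
    · obtain ⟨s, hs, hcreates⟩ := ih hold
      exact ⟨s, hs.trans t.lt_succ_self, hcreates⟩
    · by_cases hr : E.Running t v
      · exact ⟨t, t.lt_succ_self, hr, h, fun hc =>
          hold (owner_knows_of_received (mem_received_of_isWave hr hf hc) ho)⟩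
      · exact absurd ((knowledge_and_peers_succ_of_not_running hr).1 ▸ h) hold

theorem mem_peers_of_spanner_adj (ht : E.firstWake ≤ t) (h : E.spanner.Adj v w) :
    E.id w ∈ E.peers t v :=
  (mem_peers_iff ht).2 ⟨w, h, rfl⟩

theorem knowledge_subset_of_sends (ht : E.firstWake ≤ t) (hvw : E.spanner.Adj v w)
    (hv : E.Running t v) (hs : E.Sends t v) (hw : E.Running (t + 1) w) :
    E.knowledge (t + 1) v ⊆ E.knowledge (t + 2) w :=
  (knowledge_subset_received_of_message
    (message_of_sends hv (mem_peers_of_spanner_adj (by omega) hvw) hs)).trans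
    (received_subset_knowledge_succ hw)

theorem mem_knowledge_succ_of_spanner_adj (hf : f.IsWave) (ho : f.owner = E.id v)
    (h : f ∈ E.knowledge t v) (hvw : E.spanner.Adj v w) (hw : E.Running t w) :
    f ∈ E.knowledge (t + 1) w := by
  obtain ⟨s, hs, hcreates⟩ := exists_creates hf ho h
  have hsends : E.Sends s v :=
    Or.inr (Or.inr ⟨f, hcreates.mem_knowledge, hcreates.notMem_clustered⟩)
  exact knowledge_mono (by omega) w (knowledge_subset_of_sends hcreates.firstWake_le hvw
    hcreates.running hsends (hw.of_le hs) hcreates.mem_knowledge)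

theorem creates_of_adopt (h : .adopt (E.id v) x r ∈ E.knowledge t v) :
    r < t ∧ E.Creates r v (.adopt (E.id v) x r) ∧ (∀ r', .adopt (E.id v) x r' ∉ E.clustered r v) ∧
      (x = E.id v ∧ E.IsCandidate v ∨
        ∃ w, E.spanner.Adj v w ∧ ∃ r', .adopt (E.id w) x r' ∈ E.knowledge r w) := by
  obtain ⟨s, hs, hcreates⟩ := exists_creates (f := .adopt _ _ _) trivial rfl h
  rcases hcreates.cases.2 with hadopt | hdone
  · obtain ⟨x', hx, hnew, hsource⟩ := (mem_adoptFacts hcreates.running).1 hadopt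
    cases hx
    refine ⟨hs, hcreates, hnew, hsource.imp_right ?_⟩
    rintro ⟨i, hi, r', hr'⟩
    obtain ⟨w, hw, rfl⟩ := (mem_peers_iff (hcreates.firstWake_le.trans r.le_succ)).1 hi
    exact ⟨w, hw, r', owner_knows_of_received
      (mem_received_of_isWave (f := .adopt _ _ _) hcreates.running trivial hr') rfl⟩
  · obtain ⟨x', hx, -⟩ := mem_doneFacts.1 hdone
    cases hx

theorem adopt_round_unique (h : .adopt (E.id v) x r ∈ E.knowledge t v)
    (h' : .adopt (E.id v) x r' ∈ E.knowledge t' v) : r = r' := by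
  wlog hlt : r < r' generalizing r r' t t'
  · exact (Nat.le_of_not_lt hlt).antisymm' <| Nat.le_of_not_lt fun hlt' => hlt'.ne (this h' h hlt')
  have hknown := knowledge_mono hlt v (creates_of_adopt h).2.1.mem_knowledge
  exact absurd (received_subset_clustered r' v (knowledge_subset_received r' v hknown))
    ((creates_of_adopt h').2.2.1 r)

theorem exists_isCandidate_of_adopt (h : .adopt (E.id v) x r ∈ E.knowledge t v) :
    ∃ z, E.id z = x ∧ E.IsCandidate z := by
  induction r using Nat.strong_induction_on generalizing t v with
  | _ r ih =>
    rcases (creates_of_adopt h).2.2.2 with ⟨rfl, hc⟩ | ⟨w, -, r', hr'⟩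
    · exact ⟨v, rfl, hc⟩
    · exact ih r' (creates_of_adopt hr').1 hr'

theorem exists_adopt_succ (ht : E.lastWake ≤ t) (hr : E.Running t v)
    (h : x = E.id v ∧ E.IsCandidate v ∨
      ∃ i ∈ E.peers (t + 1) v, ∃ r, .adopt i x r ∈ E.clustered t v) :
    ∃ r, .adopt (E.id v) x r ∈ E.knowledge (t + 1) v := by
  by_cases hold : ∃ r, .adopt (E.id v) x r ∈ E.clustered t v
  · obtain ⟨r, hr'⟩ := hold
    exact ⟨r, clustered_subset_knowledge_succ hr hr'⟩
  · exact ⟨t, adopted_subset_knowledge_succ hr ((wakeRound_le_lastWake v).trans ht)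
      (Or.inr ((mem_adoptFacts hr).2 ⟨x, rfl, not_exists.1 hold, h⟩))⟩

theorem firstWake_le_lastWake (v : V) : E.firstWake ≤ E.lastWake :=
  (firstWake_le_wakeRound v).trans (wakeRound_le_lastWake v)

theorem exists_adopt {T : ℕ} (hT : ∀ w, E.Running T w) (hz : E.IsCandidate z)
    (p : E.spanner.Walk v z) (hp : E.lastWake + 2 * p.length ≤ T) :
    ∃ r, .adopt (E.id v) (E.id z) r ∈ E.knowledge (E.lastWake + 2 * p.length + 1) v := by
  induction p with
  | nil => exact exists_adopt_succ (Nat.le_add_right _ _) ((hT _).of_le hp) (Or.inl ⟨rfl, hz⟩)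
  | @cons v w z hvw p ih =>
    rw [SimpleGraph.Walk.length_cons] at hp ⊢
    obtain ⟨r, hr⟩ := ih hz (by omega)
    have hwake := firstWake_le_lastWake (E := E) v
    have hv : .adopt (E.id w) (E.id z) r ∈ E.knowledge (E.lastWake + 2 * p.length + 1 + 1) v :=
      mem_knowledge_succ_of_spanner_adj trivial rfl hr hvw.symm ((hT v).of_le (by omega))
    exact exists_adopt_succ (t := E.lastWake + 2 * (p.length + 1)) (by omega) ((hT v).of_le hp)
      (Or.inr ⟨E.id w, mem_peers_of_spanner_adj (by omega) hvw, r,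
        received_subset_clustered _ _ (knowledge_subset_received _ _ hv)⟩)

/-- Echos are finished in the reverse order of adoption: the later a wave has been adopted before
round `M`, the sooner its echo is finished. -/
theorem done_mem_knowledge {T M : ℕ} (hT : ∀ w, E.Running T w) (hM : E.lastWake ≤ M)
    (hadopt : ∀ v, ∃ r, .adopt (E.id v) x r ∈ E.knowledge M v) (i : ℕ) (hi : M + 2 * i ≤ T)
    (hr : .adopt (E.id v) x r ∈ E.knowledge M v) (hMr : M ≤ r + i) :
    .done (E.id v) x ∈ E.knowledge (M + 2 * i) v := by
  induction i generalizing v r with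
  | zero => exact absurd (creates_of_adopt hr).1 (Nat.not_lt.2 hMr)
  | succ i ih =>
    have hwake := wakeRound_le_lastWake (E := E) v
    have hfirst := firstWake_le_lastWake (E := E) v
    have hrun : E.Running (M + 2 * i + 1) v := (hT v).of_le (by omega)
    have hknow : ∀ {t}, t ≤ M + 2 * i + 1 → E.knowledge t v ⊆ E.adopted (M + 2 * i + 1) v :=
      fun ht => (knowledge_mono ht v).trans (knowledge_subset_adopted _ _)
    refine (mem_knowledge_succ hrun).2 (Or.inr (Or.inr ⟨by omega, mem_doneFacts.2
      ⟨x, rfl, r, hknow (by omega) hr, fun j hj => ?_⟩⟩))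
    obtain ⟨w, hvw, rfl⟩ := (mem_peers_iff (by omega)).1 hj
    obtain ⟨r', hr'⟩ := hadopt w
    refine ⟨r', hknow (by omega) (mem_knowledge_succ_of_spanner_adj trivial rfl hr' hvw.symm
      ((hT v).of_le (by omega))), fun hlt => hknow le_rfl ?_⟩
    exact mem_knowledge_succ_of_spanner_adj trivial rfl (ih (by omega) hr' (by omega)) hvw.symm
      ((hT v).of_le (by omega))

theorem node_mem_knowledge (t : ℕ) (v : V) : .node (E.id v) (E.nbrIds v) ∈ E.knowledge t v :=
  knowledge_mono t.zero_le v rfl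

/-- The set `K` contains a certificate for every finished echo in `K`: the adoption of the wave by
all neighbours in the spanner and the finished echos of the neighbours that adopted it later. -/
def EchoClosed (E : Execution V) (K : Set LocalFact) : Prop :=
  ∀ v x, .done (E.id v) x ∈ K → .node (E.id v) (E.nbrIds v) ∈ K ∧
    ∃ r, .adopt (E.id v) x r ∈ K ∧ ∀ w, E.spanner.Adj v w →
      ∃ r', .adopt (E.id w) x r' ∈ K ∧ (r < r' → .done (E.id w) x ∈ K)

theorem exists_knowledge_of_mem_received (hr : E.Running t v) (h : f ∈ E.received t v) :
    ∃ w, f ∈ E.knowledge t w ∧ E.knowledge t w ⊆ E.knowledge (t + 1) v := by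
  rcases mem_received.1 h with h | ⟨w, K, hK, hf⟩
  · exact ⟨v, h, knowledge_subset_succ t v⟩
  · exact ⟨w, eq_knowledge_of_message hK ▸ hf,
      (knowledge_subset_received_of_message hK).trans (received_subset_knowledge_succ hr)⟩

theorem Creates.echo (h : E.Creates t v (.done (E.id w) x)) :
    w = v ∧ ∃ r, .adopt (E.id v) x r ∈ E.adopted t v ∧ ∀ w, E.spanner.Adj v w →
      ∃ r', .adopt (E.id w) x r' ∈ E.adopted t v ∧ (r < r' → .done (E.id w) x ∈ E.adopted t v) := by
  rcases h.cases.2 with hadopt | hdone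
  · obtain ⟨_, hx, -⟩ := (mem_adoptFacts h.running).1 hadopt
    cases hx
  · obtain ⟨x', hx, r, hr, hpeers⟩ := mem_doneFacts.1 hdone
    obtain ⟨hid, rfl⟩ := LocalFact.done.inj hx
    exact ⟨id_inj.1 hid, r, hr, fun w hw =>
      hpeers _ (mem_peers_of_spanner_adj (h.firstWake_le.trans t.le_succ) hw)⟩

theorem echoClosed_knowledge (t : ℕ) (v : V) : E.EchoClosed (E.knowledge t v) := by
  induction t generalizing v with
  | zero => exact fun u x h => by simp [knowledge_zero] at h
  | succ t ih =>
    by_cases hr : E.Running t v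
    · intro u x h
      by_cases hc : .done (E.id u) x ∈ E.clustered t v
      · obtain ⟨w, hw, hsub⟩ := exists_knowledge_of_mem_received hr
          (mem_received_of_isWave (f := .done _ _) hr trivial hc)
        obtain ⟨hnode, r, hadopt, hnbrs⟩ := ih w u x hw
        refine ⟨hsub hnode, r, hsub hadopt, fun w' hw' => ?_⟩
        obtain ⟨r', hadopt', hdone⟩ := hnbrs w' hw'
        exact ⟨r', hsub hadopt', fun hlt => hsub (hdone hlt)⟩
      · have hcreates : E.Creates t v (.done (E.id u) x) := ⟨hr, h, hc⟩
        obtain ⟨rfl, r, hadopt, hnbrs⟩ := hcreates.echo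
        have hsub := adopted_subset_knowledge_succ hr hcreates.cases.1
        refine ⟨node_mem_knowledge _ _, r, hsub hadopt, fun w hw => ?_⟩
        obtain ⟨r', hadopt', hdone⟩ := hnbrs w hw
        exact ⟨r', hsub hadopt', fun hlt => hsub (hdone hlt)⟩
    · rw [(knowledge_and_peers_succ_of_not_running hr).1]
      exact ih v

/-- Before round `t` the node `v` knows all nodes of the network. -/
def KnowsNetwork (E : Execution V) (t : ℕ) (v : V) : Prop :=
  ∀ u, .node (E.id u) (E.nbrIds u) ∈ E.knowledge t v

/-- Every node has adopted the wave after a neighbour that adopted it earlier, so the certificate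
for the echo of the candidate propagates to all nodes. -/
theorem knowsNetwork_of_done {M : ℕ}
    (hadopt : ∀ v, ∃ r, .adopt (E.id v) (E.id z) r ∈ E.knowledge M v)
    (hdone : .done (E.id z) (E.id z) ∈ E.knowledge t z) : E.KnowsNetwork t z := by
  have hecho : ∀ r v, .adopt (E.id v) (E.id z) r ∈ E.knowledge M v →
      .done (E.id v) (E.id z) ∈ E.knowledge t z := by
    intro r
    induction r using Nat.strong_induction_on with
    | _ r ih =>
      intro v hv
      obtain ⟨hrM, -, -, ⟨h, -⟩ | ⟨w, hvw, r', hr'⟩⟩ := creates_of_adopt hv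
      · rwa [← id_inj.1 h]
      · have hlt := (creates_of_adopt hr').1
        have hw := ih r' hlt w (knowledge_mono hrM.le w hr')
        obtain ⟨-, r₁, hr₁, hnbrs⟩ := echoClosed_knowledge t z w _ hw
        obtain ⟨r₂, hr₂, hlater⟩ := hnbrs v hvw.symm
        have hw_round : r₁ = r' := adopt_round_unique (owner_knows hr₁ rfl) hr'
        have hv_round : r₂ = r := adopt_round_unique (owner_knows hr₂ rfl) hv
        exact hlater (by rwa [hw_round, hv_round])
  intro u
  obtain ⟨r, hr⟩ := hadopt u
  exact (echoClosed_knowledge t z u _ (hecho r u hr)).1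

/-! ### Termination -/

theorem nbrIds_of_node_mem {nbrs : Finset ℕ} (h : .node (E.id v) nbrs ∈ E.knowledge t v) :
    nbrs = E.nbrIds v := by
  induction t with
  | zero =>
    rw [knowledge_zero, Set.mem_singleton_iff] at h
    exact (LocalFact.node.inj h).2
  | succ t ih =>
    by_cases hr : E.Running t v
    · rcases (mem_knowledge_succ hr).1 h with (h | h) | ⟨-, h⟩ | ⟨-, h⟩
      · exact ih (owner_knows_of_received h rfl)
      · rcases mem_joined_cases hr h with ⟨_, _, _, _, _, _, _, h⟩ | ⟨-, h⟩ <;> cases h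
      · obtain ⟨_, hx, -⟩ := (mem_adoptFacts hr).1 h
        cases hx
      · obtain ⟨_, hx, -⟩ := mem_doneFacts.1 h
        cases hx
    · exact ih ((knowledge_and_peers_succ_of_not_running hr).1 ▸ h)

theorem exists_of_node_mem {i : ℕ} {nbrs : Finset ℕ} (h : .node i nbrs ∈ E.knowledge t v) :
    ∃ u, E.id u = i ∧ nbrs = E.nbrIds u := by
  obtain ⟨u, rfl, hu⟩ := exists_owner_knows h
  exact ⟨u, rfl, nbrIds_of_node_mem hu⟩

theorem knowsNetwork_of_adjacencyClosed (h : AdjacencyClosed (E.knowledge t v)) :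
    E.KnowsNetwork t v := by
  have hwalk : ∀ {a b : V}, E.graph.Walk a b → .node (E.id a) (E.nbrIds a) ∈ E.knowledge t v →
      .node (E.id b) (E.nbrIds b) ∈ E.knowledge t v := by
    intro a b p
    induction p with
    | nil => exact fun ha => ha
    | @cons a b _ hab _ ih =>
      intro ha
      obtain ⟨nbrs, hb⟩ := h _ _ ha _ (id_mem_nbrIds.2 hab)
      obtain ⟨w, hw, rfl⟩ := exists_of_node_mem hb
      exact ih (id_inj.1 hw ▸ hb)
  intro u
  obtain ⟨p⟩ := E.connected v u
  exact hwalk p (node_mem_knowledge t v)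

theorem KnowsNetwork.adjacencyClosed (h : E.KnowsNetwork t v) :
    AdjacencyClosed (E.knowledge t v) := by
  intro i nbrs hi j hj
  obtain ⟨u, rfl, rfl⟩ := exists_of_node_mem hi
  obtain ⟨w, -, rfl⟩ := mem_nbrIds.1 hj
  exact ⟨_, h w⟩

theorem KnowsNetwork.mono (h : t ≤ t') (hv : E.KnowsNetwork t v) : E.KnowsNetwork t' v :=
  fun u => knowledge_mono h v (hv u)

theorem KnowsNetwork.setOf_node_eq (h : E.KnowsNetwork t v) :
    {i | ∃ nbrs, .node i nbrs ∈ E.knowledge t v} = Set.range E.id := by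
  refine Set.Subset.antisymm ?_ ?_
  · rintro i ⟨nbrs, hi⟩
    obtain ⟨u, rfl, -⟩ := exists_of_node_mem hi
    exact ⟨u, rfl⟩
  · rintro i ⟨u, rfl⟩
    exact ⟨_, h u⟩

theorem KnowsNetwork.not_running (h : E.KnowsNetwork (t + 1) v) (hw : E.wakeRound v ≤ t) :
    ¬ E.Running (t + 1) v := by
  intro hr
  have hout := hr
  rw [Running, output_succ hr.of_succ, if_pos ⟨hw, h.adjacencyClosed⟩] at hout
  contradiction

theorem exists_halting_round (h : ¬ E.Running t v) :
    ∃ s < t, E.Running s v ∧ E.wakeRound v ≤ s ∧ E.KnowsNetwork (s + 1) v ∧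
      (E.state t v).output = some (sInf (Set.range E.id)) := by
  induction t with
  | zero => exact absurd (running_zero v) h
  | succ t ih =>
    by_cases hr : E.Running t v
    · have hhalts : E.wakeRound v ≤ t ∧ AdjacencyClosed (E.knowledge (t + 1) v) := by
        by_contra hn
        exact h ((output_succ hr).trans (if_neg hn))
      have hknows := knowsNetwork_of_adjacencyClosed hhalts.2
      refine ⟨t, t.lt_succ_self, hr, hhalts.1, hknows, ?_⟩
      rw [output_succ hr, if_pos hhalts, hknows.setOf_node_eq]
    · obtain ⟨s, hs, hspec⟩ := ih hr
      rw [state_succ_of_not_running hr]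
      exact ⟨s, hs.trans t.lt_succ_self, hspec⟩

theorem not_running_of_walk (ht : E.lastWake ≤ t) (hv : ¬ E.Running t v)
    (p : E.spanner.Walk w v) : ¬ E.Running (t + 2 * p.length) w := by
  induction p with
  | nil => exact hv
  | @cons w w' v h p ih =>
    rw [SimpleGraph.Walk.length_cons]
    intro hr
    obtain ⟨s, hs, hrun, hwake, hknows, -⟩ := exists_halting_round (ih hv)
    have hsub := knowledge_subset_of_sends ((firstWake_le_wakeRound w').trans hwake) h.symm hrun
      (Or.inr (Or.inl ⟨hwake, hknows.adjacencyClosed⟩)) (hr.of_le (by omega))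
    have hknows' : E.KnowsNetwork (s + 2) w := fun u => hsub (hknows u)
    have := wakeRound_le_lastWake (E := E) w
    exact (hknows'.mono (by omega)).not_running (t := t + 2 * p.length + 1) (by omega) hr

section Election

variable {L : ℕ} (hL : ∀ v w, ∃ p : E.spanner.Walk v w, p.length ≤ L)
include hL

theorem exists_not_running (hz : E.IsCandidate z) :
    ∃ v, ¬ E.Running (3 * (E.lastWake + 2 * L + 1) + 1) v := by
  by_contra! hT
  set M := E.lastWake + 2 * L + 1
  have hadopt : ∀ v, ∃ r, .adopt (E.id v) (E.id z) r ∈ E.knowledge M v := by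
    intro v
    obtain ⟨p, hp⟩ := hL v z
    obtain ⟨r, hr⟩ := exists_adopt hT hz p (by omega)
    exact ⟨r, knowledge_mono (by omega) v hr⟩
  obtain ⟨r, hr⟩ := hadopt z
  have hdone : .done (E.id z) (E.id z) ∈ E.knowledge (M + 2 * M) z :=
    done_mem_knowledge hT (by omega) hadopt M (by omega) hr (by omega)
  have := wakeRound_le_lastWake (E := E) z
  exact ((knowsNetwork_of_done hadopt hdone).mono (by omega)).not_running (t := 3 * M)
    (by omega) (hT z)

theorem electsLeaderWithin (hz : E.IsCandidate z) {R : ℝ}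
    (hR : ((3 * E.lastWake + 8 * L + 4 : ℕ) : ℝ) ≤ R) :
    E.algorithm.ElectsLeaderWithin E.network E.ω R := by
  obtain ⟨v₀, hv₀⟩ := exists_not_running hL hz
  have hhalted : ∀ w, ¬ E.Running (3 * E.lastWake + 8 * L + 4) w := by
    intro w hw
    obtain ⟨p, hp⟩ := hL w v₀
    exact not_running_of_walk (by omega) hv₀ p (hw.of_le (by omega))
  obtain ⟨l, hl⟩ := Nat.sInf_mem (s := Set.range E.id) ⟨_, z, rfl⟩
  refine ⟨_, hR, l, fun v => ?_⟩
  obtain ⟨-, -, -, -, -, hout⟩ := exists_halting_round (hhalted v)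
  exact hout.trans (congrArg some hl.symm)

end Election

end Execution

namespace Execution

variable {V : Type u} [Fintype V] {E : Execution V} {t : ℕ} {v w z : V} {f : LocalFact}

/-! ### The number of messages -/

open Classical in
/-- The set of all candidates. -/
noncomputable def candidates (E : Execution V) : Finset V := Finset.univ.filter E.IsCandidate

open Classical in
theorem mem_candidates : z ∈ E.candidates ↔ E.IsCandidate z := by
  simp only [candidates, Finset.mem_filter, Finset.mem_univ, true_and]

theorem Creates.exists_candidate (h : E.Creates t v f) : ∃ z ∈ E.candidates,
    f = .adopt (E.id v) (E.id z) t ∨ f = .done (E.id v) (E.id z) := by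
  have hcandidate : ∀ {x r}, .adopt (E.id v) x r ∈ E.knowledge (t + 1) v →
      ∃ z ∈ E.candidates, E.id z = x := by
    intro x r hx
    obtain ⟨z, hz, hc⟩ := exists_isCandidate_of_adopt hx
    exact ⟨z, mem_candidates.2 hc, hz⟩
  obtain ⟨hwake, hadopt | hdone⟩ := h.cases
  · obtain ⟨x, rfl, -⟩ := (mem_adoptFacts h.running).1 hadopt
    obtain ⟨z, hz, rfl⟩ := hcandidate h.mem_knowledge
    exact ⟨z, hz, Or.inl rfl⟩
  · obtain ⟨x, rfl, r, hr, -⟩ := mem_doneFacts.1 hdone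
    obtain ⟨z, hz, rfl⟩ := hcandidate (adopted_subset_knowledge_succ h.running hwake hr)
    exact ⟨z, hz, Or.inr rfl⟩

theorem sends_cases (hr : E.Running t v) (hs : E.Sends t v) : t < E.lastWake ∨
    ¬ E.Running (t + 1) v ∨ (∃ z ∈ E.candidates, E.Creates t v (.adopt (E.id v) (E.id z) t)) ∨
      ∃ z ∈ E.candidates, E.Creates t v (.done (E.id v) (E.id z)) := by
  rcases hs with ht | ⟨hwake, hclosed⟩ | ⟨f, hf, hnew⟩
  · exact Or.inl (ht.trans_le (wakeRound_le_lastWake v))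
  · exact Or.inr (Or.inl ((knowsNetwork_of_adjacencyClosed hclosed).not_running hwake))
  · have hcreates : E.Creates t v f := ⟨hr, hf, hnew⟩
    obtain ⟨z, hz, rfl | rfl⟩ := hcreates.exists_candidate
    · exact Or.inr (Or.inr (Or.inl ⟨z, hz, hcreates⟩))
    · exact Or.inr (Or.inr (Or.inr ⟨z, hz, hcreates⟩))

open Classical in
theorem card_halting_le_one (S : Finset ℕ) (v : V) :
    (S.filter fun t => E.Running t v ∧ ¬ E.Running (t + 1) v).card ≤ 1 := by
  refine Finset.card_le_one.2 fun t ht t' ht' => ?_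
  obtain ⟨-, hr, hn⟩ := Finset.mem_filter.1 ht
  obtain ⟨-, hr', hn'⟩ := Finset.mem_filter.1 ht'
  exact le_antisymm (not_lt.1 fun hlt => hn' (hr.of_le hlt))
    (not_lt.1 fun hlt => hn (hr'.of_le hlt))

open Classical in
theorem card_adopting_le (S : Finset ℕ) (v : V) :
    (S.filter fun t => ∃ z ∈ E.candidates, E.Creates t v (.adopt (E.id v) (E.id z) t)).card ≤
      E.candidates.card :=
  Finset.card_le_card_of_forall_subsingleton
    (fun t z => E.Creates t v (.adopt (E.id v) (E.id z) t))
    (fun _ ht => (Finset.mem_filter.1 ht).2)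
    (fun _ _ _ ht _ ht' => adopt_round_unique ht.2.mem_knowledge ht'.2.mem_knowledge)

open Classical in
theorem card_finishing_le (S : Finset ℕ) (v : V) :
    (S.filter fun t => ∃ z ∈ E.candidates, E.Creates t v (.done (E.id v) (E.id z))).card ≤
      E.candidates.card :=
  Finset.card_le_card_of_forall_subsingleton
    (fun t z => E.Creates t v (.done (E.id v) (E.id z)))
    (fun _ ht => (Finset.mem_filter.1 ht).2)
    (fun _ _ _ ht _ ht' => ht.2.eq ht'.2)

open Classical in
theorem card_sends_le (S : Finset ℕ) (v : V) :
    (S.filter fun t => E.Running t v ∧ E.Sends t v).card ≤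
      E.lastWake + 2 * E.candidates.card + 1 := by
  have hcover : (S.filter fun t => E.Running t v ∧ E.Sends t v) ⊆
      Finset.range E.lastWake ∪ (S.filter fun t => E.Running t v ∧ ¬ E.Running (t + 1) v) ∪
      (S.filter fun t => ∃ z ∈ E.candidates, E.Creates t v (.adopt (E.id v) (E.id z) t)) ∪
      (S.filter fun t => ∃ z ∈ E.candidates, E.Creates t v (.done (E.id v) (E.id z))) := by
    intro t ht
    obtain ⟨hS, hr, hs⟩ := Finset.mem_filter.1 ht
    simp only [Finset.mem_union, Finset.mem_range, Finset.mem_filter, hS, hr, true_and, or_assoc]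
    exact sends_cases hr hs
  have hcard := (Finset.card_le_card hcover).trans ((Finset.card_union_le _ _).trans
    (Nat.add_le_add_right ((Finset.card_union_le _ _).trans
      (Nat.add_le_add_right (Finset.card_union_le _ _) _)) _))
  rw [Finset.card_range] at hcard
  have := card_halting_le_one (E := E) S v
  have := card_adopting_le (E := E) S v
  have := card_finishing_le (E := E) S v
  omega

theorem spanner_adj_of_mem_peers (h : E.id w ∈ E.peers t v) : E.spanner.Adj v w := by
  rcases le_total t E.firstWake with ht | ht
  · exact peers_mono ht v h
  · rwa [peers_eq_peers_firstWake ht] at h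

open Classical in
theorem messagesInRound_le (t : ℕ) : E.algorithm.messagesInRound E.network E.ω t ≤
    (E.spannerPairs.filter fun e => E.Running t e.1 ∧ E.Sends t e.1).card := by
  refine Finset.card_le_card fun e he => ?_
  obtain ⟨K, hK⟩ := Option.isSome_iff_exists.1 (Finset.mem_filter.1 he).2
  obtain ⟨hr, hp, hs, -⟩ := of_message_succ (E := E) hK
  exact Finset.mem_filter.2 ⟨Finset.mem_filter.2
    ⟨Finset.mem_univ e, spanner_adj_of_mem_peers hp⟩, hr, hs⟩

theorem messagesAtMost {R : ℕ} (hR : ∀ x, (E.nearCentres x).card ≤ R) {B : ℝ}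
    (hB : ((2 * (Fintype.card V * R) * (E.lastWake + 2 * E.candidates.card + 1) : ℕ) : ℝ) ≤ B) :
    E.algorithm.MessagesAtMost E.network E.ω B := by
  classical
  refine fun T => le_trans (Nat.cast_le.2 ?_) hB
  calc ∑ t ∈ Finset.range T, E.algorithm.messagesInRound E.network E.ω t
      ≤ ∑ t ∈ Finset.range T,
          (E.spannerPairs.filter fun e => E.Running t e.1 ∧ E.Sends t e.1).card :=
        Finset.sum_le_sum fun t _ => messagesInRound_le t
    _ = ∑ e ∈ E.spannerPairs,
          ((Finset.range T).filter fun t => E.Running t e.1 ∧ E.Sends t e.1).card :=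
        Finset.sum_card_bipartiteAbove_eq_sum_card_bipartiteBelow _
    _ ≤ E.spannerPairs.card * (E.lastWake + 2 * E.candidates.card + 1) :=
        Finset.sum_le_card_nsmul _ _ _ fun e _ => card_sends_le _ e.1
    _ ≤ _ := Nat.mul_le_mul_right _ (card_spannerPairs_le hR)

end Execution

/-! ### Coin tosses -/

/-- The distribution of independent fair coins indexed by `ι`. -/
noncomputable def fairCoins (ι : Type*) : Measure (ι → Bool) :=
  Measure.infinitePi fun _ => (PMF.uniformOfFintype Bool).toMeasure

instance (ι : Type*) : IsProbabilityMeasure (fairCoins ι) := by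
  unfold fairCoins; infer_instance

instance (V : Type u) : IsProbabilityMeasure (coinMeasure V) :=
  inferInstanceAs (IsProbabilityMeasure (fairCoins (V × ℕ × ℕ)))

theorem setOf_forall_eq_true {ι : Type*} (s : Finset ι) :
    {x : ι → Bool | ∀ i ∈ s, x i = true} = (s : Set ι).pi fun _ => {true} := rfl

theorem measurableSet_forall_eq_true {ι : Type*} (s : Finset ι) :
    MeasurableSet {x : ι → Bool | ∀ i ∈ s, x i = true} :=
  MeasurableSet.pi s.countable_toSet fun _ _ => MeasurableSet.singleton true

theorem fairCoins_real_forall_eq_true {ι : Type*} (s : Finset ι) :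
    (fairCoins ι).real {x | ∀ i ∈ s, x i = true} = 1 / 2 ^ s.card := by
  rw [setOf_forall_eq_true, measureReal_def, fairCoins,
    Measure.infinitePi_pi _ fun _ _ => MeasurableSet.singleton true, Finset.prod_const,
    PMF.toMeasure_apply_singleton _ _ (MeasurableSet.singleton true)]
  simp

/-- The event that the first `j` of the coins that a node tosses in round `0` show heads. -/
def headsEvent (j : ℕ) : Set (ℕ × ℕ → Bool) := {x | ∀ i < j, x (0, i) = true}

theorem headsEvent_antitone : Antitone headsEvent :=
  fun _ _ hj _ hx i hi => hx i (hi.trans_le hj)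

theorem headsEvent_eq (j : ℕ) : headsEvent j =
    {x | ∀ i ∈ (Finset.range j).map (Function.Embedding.sectR 0 ℕ), x i = true} := by
  simp [headsEvent]

theorem measurableSet_headsEvent (j : ℕ) : MeasurableSet (headsEvent j) :=
  headsEvent_eq j ▸ measurableSet_forall_eq_true _

theorem fairCoins_real_headsEvent (j : ℕ) :
    (fairCoins (ℕ × ℕ)).real (headsEvent j) = 1 / 2 ^ j := by
  rw [headsEvent_eq, fairCoins_real_forall_eq_true, Finset.card_map, Finset.card_range]

theorem integrable_indicator_headsEvent (j : ℕ) :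
    Integrable ((headsEvent j).indicator 1 : _ → ℝ) (fairCoins (ℕ × ℕ)) :=
  (integrable_const 1).indicator (measurableSet_headsEvent j)

theorem integral_indicator_headsEvent (j : ℕ) :
    ∫ x, (headsEvent j).indicator 1 x ∂fairCoins (ℕ × ℕ) = (1 / 2 ^ j : ℝ) := by
  rw [integral_indicator_one (measurableSet_headsEvent j), fairCoins_real_headsEvent]

/-- A nonnegative function of the coins of a node with expectation `1`, equal to `8 / 7` if there
are at least `j` but fewer than `j + 3` leading heads. -/
noncomputable def gapFactor (j : ℕ) (x : ℕ × ℕ → Bool) : ℝ :=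
  1 + 1 / 7 * (headsEvent j).indicator 1 x - 8 / 7 * (headsEvent (j + 3)).indicator 1 x

theorem gapFactor_nonneg (j : ℕ) (x : ℕ × ℕ → Bool) : 0 ≤ gapFactor j x := by
  have hanti : (headsEvent (j + 3)).indicator 1 x ≤ ((headsEvent j).indicator 1 x : ℝ) :=
    Set.indicator_le_indicator_of_subset (headsEvent_antitone (Nat.le_add_right j 3))
      (fun _ => zero_le_one) x
  have hone : (headsEvent (j + 3)).indicator 1 x ≤ (1 : ℝ) :=
    Set.indicator_le_self' (fun _ _ => zero_le_one) x
  unfold gapFactor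
  linarith

theorem integrable_one_add_indicator (j : ℕ) (q : ℝ) :
    Integrable (fun x => 1 + q * (headsEvent j).indicator 1 x) (fairCoins (ℕ × ℕ)) :=
  (integrable_const 1).add ((integrable_indicator_headsEvent j).const_mul q)

theorem integral_one_add_indicator (j : ℕ) (q : ℝ) :
    ∫ x, (1 + q * (headsEvent j).indicator 1 x) ∂fairCoins (ℕ × ℕ) = 1 + q * (1 / 2 ^ j) := by
  rw [integral_add (integrable_const 1) ((integrable_indicator_headsEvent j).const_mul q),
    integral_const_mul, integral_indicator_headsEvent, integral_const, probReal_univ, one_smul]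

theorem integrable_gapFactor (j : ℕ) : Integrable (gapFactor j) (fairCoins (ℕ × ℕ)) :=
  (integrable_one_add_indicator j _).sub ((integrable_indicator_headsEvent _).const_mul _)

theorem integral_gapFactor (j : ℕ) : ∫ x, gapFactor j x ∂fairCoins (ℕ × ℕ) = 1 := by
  simp only [gapFactor]
  rw [integral_sub (integrable_one_add_indicator j _)
    ((integrable_indicator_headsEvent _).const_mul _), integral_one_add_indicator,
    integral_const_mul, integral_indicator_headsEvent, pow_add]
  field_simp
  ring

theorem measureReal_pi_le_prod_integral_div {ι : Type*} [Fintype ι] {X : ι → Type*}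
    [∀ i, MeasurableSpace (X i)] {μ : ∀ i, Measure (X i)} [∀ i, IsFiniteMeasure (μ i)]
    {f : ∀ i, X i → ℝ} (hf : ∀ i, Integrable (f i) (μ i)) (hf₀ : ∀ i x, 0 ≤ f i x) {l : ℝ}
    (hl : 0 < l) {S : Set (∀ i, X i)} (hS : ∀ x ∈ S, l ≤ ∏ i, f i (x i)) :
    (Measure.pi μ).real S ≤ (∏ i, ∫ x, f i x ∂μ i) / l := by
  rw [le_div_iff₀' hl, ← integral_fintype_prod_eq_prod]
  exact (mul_le_mul_of_nonneg_left (measureReal_mono hS) hl.le).trans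
    (mul_meas_ge_le_integral_of_nonneg
      (Filter.Eventually.of_forall fun x => Finset.prod_nonneg fun i _ => hf₀ i (x i))
      (Integrable.fintype_prod_dep hf) l)

section Events

variable {V : Type u} {ω : CoinTosses V} {v : V} {j j' : ℕ}

/-- The first `j` of the coins tossed by the node `v` in round `0` show heads. -/
def Heads (ω : CoinTosses V) (v : V) (j : ℕ) : Prop := (fun i => ω (v, i)) ∈ headsEvent j

theorem Heads.mono (h : Heads ω v j') (hj : j ≤ j') : Heads ω v j := headsEvent_antitone hj h

open Classical in
theorem indicator_headsEvent_apply (ω : CoinTosses V) (v : V) (j : ℕ) :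
    (headsEvent j).indicator 1 (fun i => ω (v, i)) = if Heads ω v j then (1 : ℝ) else 0 :=
  Set.indicator_apply ..

theorem coinMeasure_real_heads (v : V) (j : ℕ) :
    (coinMeasure V).real {ω | Heads ω v j} = 1 / 2 ^ j := by
  have hset : {ω : CoinTosses V | Heads ω v j} = {ω | ∀ i ∈ (Finset.range j).map
      ((Function.Embedding.sectR 0 ℕ).trans (Function.Embedding.sectR v (ℕ × ℕ))), ω i = true} := by
    simp [Heads, headsEvent]
  rw [hset]
  refine (fairCoins_real_forall_eq_true _).trans ?_
  rw [Finset.card_map, Finset.card_range]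

variable [Fintype V]

theorem measurePreserving_curry_coinMeasure :
    MeasurePreserving (MeasurableEquiv.curry V (ℕ × ℕ) Bool) (coinMeasure V)
      (Measure.pi fun _ => fairCoins (ℕ × ℕ)) where
  measurable := MeasurableEquiv.measurable _
  map_eq := by
    rw [← Measure.infinitePi_eq_pi]
    exact Measure.infinitePi_map_curry fun _ _ => (PMF.uniformOfFintype Bool).toMeasure

theorem coinMeasure_real_le_prod_integral_div {f : V → (ℕ × ℕ → Bool) → ℝ}
    (hf : ∀ v, Integrable (f v) (fairCoins (ℕ × ℕ))) (hf₀ : ∀ v x, 0 ≤ f v x) {l : ℝ}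
    (hl : 0 < l) {S : Set (CoinTosses V)} (hS : ∀ ω ∈ S, l ≤ ∏ v, f v fun i => ω (v, i)) :
    (coinMeasure V).real S ≤ (∏ v, ∫ x, f v x ∂fairCoins (ℕ × ℕ)) / l := by
  have hmarkov := measureReal_pi_le_prod_integral_div hf hf₀ hl
    (S := (MeasurableEquiv.curry V (ℕ × ℕ) Bool).symm ⁻¹' S) fun x hx => hS _ hx
  rwa [measureReal_def,
    measurePreserving_curry_coinMeasure.symm.measure_preimage_equiv] at hmarkov

theorem coinMeasure_real_exists_heads_le (b : V → ℕ) :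
    (coinMeasure V).real {ω | ∃ v, Heads ω v (b v)} ≤ ∑ v, 1 / 2 ^ b v := by
  rw [Set.ofPred_exists]
  refine (measureReal_iUnion_fintype_le _).trans (le_of_eq ?_)
  exact Finset.sum_congr rfl fun v _ => coinMeasure_real_heads v (b v)

theorem coinMeasure_real_forall_not_heads_le (b : V → ℕ) :
    (coinMeasure V).real {ω | ∀ v, ¬ Heads ω v (b v)} ≤ ∏ v, (1 - 1 / 2 ^ b v) := by
  classical
  have hmarkov := coinMeasure_real_le_prod_integral_div
    (f := fun v x => 1 + -1 * (headsEvent (b v)).indicator 1 x)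
    (fun v => integrable_one_add_indicator (b v) (-1)) (fun v x => ?_) one_pos
    (S := {ω : CoinTosses V | ∀ v, ¬ Heads ω v (b v)}) fun ω hω => ?_
  · simp only [integral_one_add_indicator] at hmarkov
    simpa only [div_one, neg_one_mul, ← sub_eq_add_neg] using hmarkov
  · have hone : (headsEvent (b v)).indicator 1 x ≤ (1 : ℝ) :=
      Set.indicator_le_self' (fun _ _ => zero_le_one) x
    linarith
  · refine (Finset.prod_eq_one fun v _ => ?_).ge
    rw [indicator_headsEvent_apply, if_neg (hω v), mul_zero, add_zero]

open Classical in
theorem coinMeasure_real_le_card_heads_le (b : V → ℕ) (m : ℕ) :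
    (coinMeasure V).real {ω | m ≤ (Finset.univ.filter fun v => Heads ω v (b v)).card} ≤
      (∏ v, (1 + 1 / 2 ^ b v)) / 2 ^ m := by
  have hmarkov := coinMeasure_real_le_prod_integral_div
    (f := fun v x => 1 + 1 * (headsEvent (b v)).indicator 1 x)
    (fun v => integrable_one_add_indicator (b v) 1) (fun v x => ?_) (pow_pos two_pos m)
    (S := {ω : CoinTosses V | m ≤ (Finset.univ.filter fun v => Heads ω v (b v)).card})
    fun ω hω => ?_
  · simp only [integral_one_add_indicator] at hmarkov
    simpa only [one_mul] using hmarkov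
  · have hnonneg : (0 : ℝ) ≤ (headsEvent (b v)).indicator 1 x :=
      Set.indicator_nonneg (fun _ _ => zero_le_one) x
    linarith
  · have hfactor : ∀ v, (1 : ℝ) + 1 * (headsEvent (b v)).indicator 1 (fun i => ω (v, i)) =
        if Heads ω v (b v) then 2 else 1 := by
      intro v
      rw [indicator_headsEvent_apply]
      split_ifs <;> norm_num
    rw [Finset.prod_congr rfl fun v _ => hfactor v, Finset.prod_ite, Finset.prod_const,
      Finset.prod_const_one, mul_one]
    exact pow_le_pow_right₀ one_le_two hω

open Classical in
theorem coinMeasure_real_gap_le (a : V → ℕ) (m : ℕ) :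
    (coinMeasure V).real {ω | m ≤ (Finset.univ.filter fun v => Heads ω v (a v)).card ∧
      ∀ v, ¬ Heads ω v (a v + 3)} ≤ (7 / 8) ^ m := by
  have hmarkov := coinMeasure_real_le_prod_integral_div (f := fun v => gapFactor (a v))
    (fun v => integrable_gapFactor (a v)) (fun v => gapFactor_nonneg (a v))
    (l := (8 / 7) ^ m) (by positivity)
    (S := {ω : CoinTosses V | m ≤ (Finset.univ.filter fun v => Heads ω v (a v)).card ∧
      ∀ v, ¬ Heads ω v (a v + 3)}) (fun ω hω => ?_)
  · rw [Finset.prod_eq_one fun v _ => integral_gapFactor (a v), one_div, ← inv_pow,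
      inv_div] at hmarkov
    exact hmarkov
  · have hfactor : ∀ v, gapFactor (a v) (fun i => ω (v, i)) =
        if Heads ω v (a v) then 8 / 7 else 1 := by
      intro v
      rw [gapFactor, indicator_headsEvent_apply, indicator_headsEvent_apply, if_neg (hω.2 v)]
      split_ifs <;> norm_num
    rw [Finset.prod_congr rfl fun v _ => hfactor v, Finset.prod_ite, Finset.prod_const,
      Finset.prod_const_one, mul_one]
    exact pow_le_pow_right₀ (by norm_num) hω.1

open Classical in
theorem coinMeasure_real_exists_gap_le {ι : Type*} (s : Finset ι) (a : ι → V → ℕ) (m : ℕ) :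
    (coinMeasure V).real {ω | ∃ i ∈ s,
      m ≤ (Finset.univ.filter fun v => Heads ω v (a i v)).card ∧ ∀ v, ¬ Heads ω v (a i v + 3)} ≤
      s.card * (7 / 8) ^ m := by
  have hset : {ω : CoinTosses V | ∃ i ∈ s, m ≤ (Finset.univ.filter fun v =>
      Heads ω v (a i v)).card ∧ ∀ v, ¬ Heads ω v (a i v + 3)} = ⋃ i ∈ s, {ω |
      m ≤ (Finset.univ.filter fun v => Heads ω v (a i v)).card ∧ ∀ v, ¬ Heads ω v (a i v + 3)} := by
    ext ω
    simp only [Set.mem_iUnion, exists_prop, Set.mem_ofPred_eq]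
  rw [hset]
  refine (measureReal_biUnion_finset_le _ _).trans ?_
  exact (Finset.sum_le_card_nsmul _ _ _ fun i _ => coinMeasure_real_gap_le (a i) m).trans_eq
    (nsmul_eq_mul _ _)

end Events

/-! ### Good coin tosses -/

open Classical in
/-- The properties of the coins that make the algorithm succeed: no node tosses heads only, there
are candidates, but fewer than `m` of them, and if `r` nodes would reach the node `x` by phase
`τ + 2`, then some node would reach it before phase `τ`, so that `x` does not join in phase `τ`. -/
structure GoodCoins {V : Type u} [Fintype V] (N : Network V) (P : ElectionParams) (k r m : ℕ)
    (ω : CoinTosses V) : Prop where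
  not_allHeads : ∀ v, ¬ Heads ω v (P.coinCount (N.estimate v))
  exists_candidate : ∃ v, Heads ω v (P.candidateHeads (N.estimate v))
  card_candidates_lt :
    (Finset.univ.filter fun v => Heads ω v (P.candidateHeads (N.estimate v))).card < m
  exists_earlier : ∀ x, ∀ τ ∈ Finset.range (k + 1),
    r ≤ (Finset.univ.filter fun z =>
      Heads ω z (P.coinCount (N.estimate z) + N.graph.dist z x - (τ + 2))).card →
    ∃ z, Heads ω z (P.coinCount (N.estimate z) + N.graph.dist z x - (τ + 2) + 3)

theorem le_nodeHeads_iff_heads {V : Type u} {N : Network V} {P : ElectionParams}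
    {ω : CoinTosses V} {v : V} {j : ℕ} (hj : j ≤ P.coinCount (N.estimate v)) :
    j ≤ nodeHeads P N ω v ↔ Heads ω v j :=
  le_nodeHeads_iff hj

section Execution

variable {V : Type u} [Fintype V] {E : Execution V} {k r m : ℕ}

theorem GoodCoins.nodeHeads_lt (h : GoodCoins E.network E.params k r m E.ω) (v : V) :
    nodeHeads E.params E.network E.ω v < E.params.coinCount (E.network.estimate v) :=
  not_le.1 fun hle => h.not_allHeads v ((le_nodeHeads_iff_heads le_rfl).1 hle)

theorem GoodCoins.card_nearCentres_le (h : GoodCoins E.network E.params k r m E.ω)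
    (hk : ∀ v, E.startPhase v ≤ k) (x : V) : (E.nearCentres x).card ≤ r := by
  classical
  by_contra! hr
  have hτ : E.joinPhase x ∈ Finset.range (k + 1) :=
    Finset.mem_range_succ_iff.2 ((Execution.joinPhase_le_startPhase x).trans (hk x))
  obtain ⟨z, hz⟩ := h.exists_earlier x _ hτ <| hr.le.trans <| Finset.card_le_card fun z hz => by
    have hreach : E.startPhase z + E.network.graph.dist z x ≤ E.joinPhase x + 2 :=
      Execution.mem_nearCentres.1 hz
    have := h.nodeHeads_lt z
    rw [Execution.startPhase] at hreach
    exact Finset.mem_filter.2 ⟨Finset.mem_univ z,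
      (le_nodeHeads_iff_heads (N := E.network) (P := E.params) (by omega)).1 (by omega)⟩
  have hle : E.params.coinCount (E.network.estimate z) + E.network.graph.dist z x -
      (E.joinPhase x + 2) + 3 ≤ E.params.coinCount (E.network.estimate z) :=
    not_lt.1 fun hlt => h.not_allHeads z (hz.mono hlt.le)
  have hheads := (le_nodeHeads_iff_heads (N := E.network) hle).2 hz
  have hjoin : E.joinPhase x ≤ E.startPhase z + E.network.graph.dist z x := shiftedDist_le ..
  have := h.nodeHeads_lt z
  rw [Execution.startPhase] at hjoin
  omega

theorem GoodCoins.exists_isCandidate (h : GoodCoins E.network E.params k r m E.ω)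
    (hP : ∀ N, E.params.candidateHeads N ≤ E.params.coinCount N) : ∃ z, E.IsCandidate z := by
  obtain ⟨z, hz⟩ := h.exists_candidate
  exact ⟨z, (le_nodeHeads_iff_heads (hP _)).2 hz⟩

theorem GoodCoins.card_candidates_le (h : GoodCoins E.network E.params k r m E.ω)
    (hP : ∀ N, E.params.candidateHeads N ≤ E.params.coinCount N) : E.candidates.card ≤ m := by
  classical
  refine (Finset.card_le_card fun z hz => ?_).trans h.card_candidates_lt.le
  exact Finset.mem_filter.2
    ⟨Finset.mem_univ z, (le_nodeHeads_iff_heads (hP _)).1 (Execution.mem_candidates.1 hz)⟩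

theorem GoodCoins.electsLeaderWithin (h : GoodCoins E.network E.params k r m E.ω)
    (hk : ∀ v, E.startPhase v ≤ k)
    (hP : ∀ N, E.params.candidateHeads N ≤ E.params.coinCount N) {R : ℝ}
    (hR : ((3 * E.lastWake + 8 * ((2 * k + 1) * E.graph.diam) + 4 : ℕ) : ℝ) ≤ R) :
    E.algorithm.ElectsLeaderWithin E.network E.ω R := by
  have := E.connected.nonempty
  obtain ⟨z, hz⟩ := h.exists_isCandidate hP
  refine Execution.electsLeaderWithin (fun v w => ?_) hz hR
  obtain ⟨p, hp⟩ := Execution.exists_spanner_walk hk v w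
  exact ⟨p, hp.trans (Nat.mul_le_mul_left _
    (SimpleGraph.dist_le_diam (SimpleGraph.connected_iff_ediam_ne_top.1 E.connected)))⟩

theorem GoodCoins.messagesAtMost (h : GoodCoins E.network E.params k r m E.ω)
    (hk : ∀ v, E.startPhase v ≤ k)
    (hP : ∀ N, E.params.candidateHeads N ≤ E.params.coinCount N) {B : ℝ}
    (hB : ((2 * (Fintype.card V * r) * (E.lastWake + 2 * m + 1) : ℕ) : ℝ) ≤ B) :
    E.algorithm.MessagesAtMost E.network E.ω B := by
  have hcandidates := h.card_candidates_le hP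
  refine Execution.messagesAtMost (h.card_nearCentres_le hk) (le_trans (Nat.cast_le.2 ?_) hB)
  gcongr

end Execution

theorem one_sub_le_coinMeasure_real_goodCoins {V : Type u} [Fintype V] (N : Network V)
    (P : ElectionParams) (k r m : ℕ) :
    1 - (∑ v, 1 / 2 ^ P.coinCount (N.estimate v) +
        ∏ v, (1 - 1 / 2 ^ P.candidateHeads (N.estimate v)) +
        (∏ v, (1 + 1 / 2 ^ P.candidateHeads (N.estimate v))) / 2 ^ m +
        Fintype.card V * (k + 1) * (7 / 8) ^ r) ≤
      (coinMeasure V).real {ω | GoodCoins N P k r m ω} := by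
  classical
  set allHeads : Set (CoinTosses V) := {ω | ∃ v, Heads ω v (P.coinCount (N.estimate v))}
  set noCandidate : Set (CoinTosses V) := {ω | ∀ v, ¬ Heads ω v (P.candidateHeads (N.estimate v))}
  set manyCandidates : Set (CoinTosses V) := {ω | m ≤
    (Finset.univ.filter fun v => Heads ω v (P.candidateHeads (N.estimate v))).card}
  set gap : Set (CoinTosses V) := {ω | ∃ p ∈ (Finset.univ : Finset V) ×ˢ Finset.range (k + 1),
    r ≤ (Finset.univ.filter fun z =>
      Heads ω z (P.coinCount (N.estimate z) + N.graph.dist z p.1 - (p.2 + 2))).card ∧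
    ∀ z, ¬ Heads ω z (P.coinCount (N.estimate z) + N.graph.dist z p.1 - (p.2 + 2) + 3)}
  have hcover : (Set.univ : Set (CoinTosses V)) ⊆
      {ω | GoodCoins N P k r m ω} ∪ (allHeads ∪ noCandidate ∪ manyCandidates ∪ gap) := by
    intro ω _
    by_contra hω
    simp only [Set.mem_union, not_or] at hω
    obtain ⟨hgood, ⟨⟨hall, hno⟩, hmany⟩, hgap⟩ := hω
    refine hgood ⟨fun v hv => hall ⟨v, hv⟩, ?_, not_le.1 hmany, fun x τ hτ hr => ?_⟩
    · by_contra! hnone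
      exact hno hnone
    · by_contra! hlate
      exact hgap ⟨(x, τ), Finset.mem_product.2 ⟨Finset.mem_univ x, hτ⟩, hr, hlate⟩
  have hgap : (coinMeasure V).real gap ≤ Fintype.card V * (k + 1) * (7 / 8) ^ r := by
    refine (coinMeasure_real_exists_gap_le _ _ r).trans_eq ?_
    rw [Finset.card_product, Finset.card_univ, Finset.card_range]
    push_cast
    rfl
  calc _ ≤ 1 - (coinMeasure V).real (allHeads ∪ noCandidate ∪ manyCandidates ∪ gap) := by
        refine sub_le_sub_left ((measureReal_union_le _ _).trans (add_le_add ?_ hgap)) 1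
        refine (measureReal_union_le _ _).trans (add_le_add ?_
          (coinMeasure_real_le_card_heads_le _ m))
        exact (measureReal_union_le _ _).trans (add_le_add
          (coinMeasure_real_exists_heads_le _) (coinMeasure_real_forall_not_heads_le _))
    _ ≤ _ := by
        rw [sub_le_iff_le_add, ← probReal_univ (μ := coinMeasure V)]
        exact (measureReal_mono hcover).trans (measureReal_union_le _ _)

/-! ### The choice of the parameters -/

theorem clog_two_mul_le (a b : ℕ) : Nat.clog 2 (a * b) ≤ Nat.clog 2 a + Nat.clog 2 b := by
  refine Nat.clog_le_of_le_pow ?_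
  rw [pow_add]
  exact Nat.mul_le_mul (Nat.le_pow_clog one_lt_two a) (Nat.le_pow_clog one_lt_two b)

theorem clog_two_pow_mul_le (a b i : ℕ) :
    Nat.clog 2 (a ^ i * b) ≤ i * Nat.clog 2 a + Nat.clog 2 b := by
  induction i with
  | zero => rw [pow_zero, one_mul, zero_mul, zero_add]
  | succ i ih =>
    rw [pow_succ', mul_assoc, Nat.succ_mul]
    have := clog_two_mul_le a (a ^ i * b)
    omega

/-- `N` approximates `n` up to the factor `A`. -/
structure IsEstimate (A n N : ℕ) : Prop where
  le_mul : n ≤ A * N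
  mul_le : N ≤ A * n

theorem isEstimate_ceil {a : ℝ} {n N : ℕ} (h₁ : (n : ℝ) ≤ a * N) (h₂ : (N : ℝ) ≤ a * n) :
    IsEstimate ⌈a⌉₊ n N where
  le_mul := Nat.cast_le.1 <| h₁.trans <| by push_cast; gcongr; exact Nat.le_ceil a
  mul_le := Nat.cast_le.1 <| h₂.trans <| by push_cast; gcongr; exact Nat.le_ceil a

/-- The parameters for estimates that are correct up to the factor `A`. A node with estimate `N`
replaces `n` by the upper bound `A * N` and becomes a candidate with probability about
`A * (c + 2) * log n / N`, at least `(c + 2) * log n / n`. The factor `A ^ 3` in `wakeRound` makes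
up for the different estimates of different nodes. -/
def electionParams (c A : ℕ) : ElectionParams where
  coinCount N := (c + 3) * Nat.clog 2 (A * N)
  wakeRound N := ((c + 3) * Nat.clog 2 (A ^ 3 * N) + 2) ^ 2
  candidateHeads N := Nat.log 2 (N / (A * (c + 2) * Nat.clog 2 (A * N)))

/-- With estimates of `n` correct up to the factor `A`, the logarithms that occur in the algorithm
are at most `logFactor A * Nat.clog 2 n`. -/
def logFactor (A : ℕ) : ℕ := 4 * Nat.clog 2 A + 1

/-- The number of phases is at most `phaseFactor c A * Nat.clog 2 n`. -/
def phaseFactor (c A : ℕ) : ℕ := (c + 3) * logFactor A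

section Parameters

variable {c A n N i : ℕ}

theorem clog_two_pow_mul_le_logFactor_mul (hn : 2 ≤ n) (hi : i ≤ 4) :
    Nat.clog 2 (A ^ i * n) ≤ logFactor A * Nat.clog 2 n := by
  have hpos : 0 < Nat.clog 2 n := Nat.clog_pos one_lt_two hn
  calc Nat.clog 2 (A ^ i * n) ≤ i * Nat.clog 2 A + Nat.clog 2 n := clog_two_pow_mul_le _ _ _
    _ ≤ 4 * Nat.clog 2 A * Nat.clog 2 n + Nat.clog 2 n :=
        Nat.add_le_add_right
          ((Nat.mul_le_mul_right _ hi).trans (Nat.le_mul_of_pos_right _ hpos)) _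
    _ = logFactor A * Nat.clog 2 n := by rw [logFactor]; ring

namespace IsEstimate

theorem pow_mul_le (h : IsEstimate A n N) (i : ℕ) : A ^ i * N ≤ A ^ (i + 1) * n := by
  rw [pow_succ, mul_assoc]
  exact Nat.mul_le_mul_left _ h.mul_le

theorem le_pow_mul (h : IsEstimate A n N) (i : ℕ) : A ^ i * n ≤ A ^ (i + 1) * N := by
  rw [pow_succ, mul_assoc]
  exact Nat.mul_le_mul_left _ h.le_mul

theorem mul_le_sq_mul (h : IsEstimate A n N) : A * N ≤ A ^ 2 * n := by
  simpa only [pow_one] using h.pow_mul_le 1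

theorem factor_pos (h : IsEstimate A n N) (hn : 0 < n) : 0 < A :=
  Nat.pos_of_mul_pos_right (hn.trans_le h.le_mul)

theorem clog_two_mul_le_logFactor_mul (h : IsEstimate A n N) (hn : 2 ≤ n) :
    Nat.clog 2 (A * N) ≤ logFactor A * Nat.clog 2 n :=
  (Nat.clog_mono_right 2 h.mul_le_sq_mul).trans
    (clog_two_pow_mul_le_logFactor_mul hn (by norm_num))

theorem coinCount_le (h : IsEstimate A n N) :
    (electionParams c A).coinCount N ≤ (c + 3) * Nat.clog 2 (A ^ 2 * n) :=
  Nat.mul_le_mul_left _ (Nat.clog_mono_right 2 h.mul_le_sq_mul)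

theorem coinCount_le_phaseFactor_mul (h : IsEstimate A n N) (hn : 2 ≤ n) :
    (electionParams c A).coinCount N ≤ phaseFactor c A * Nat.clog 2 n := by
  rw [phaseFactor, mul_assoc]
  exact Nat.mul_le_mul_left _ (h.clog_two_mul_le_logFactor_mul hn)

theorem pow_le_two_pow_coinCount (h : IsEstimate A n N) :
    n ^ (c + 3) ≤ 2 ^ (electionParams c A).coinCount N := by
  simp only [electionParams]
  rw [mul_comm, pow_mul]
  exact Nat.pow_le_pow_left (h.le_mul.trans (Nat.le_pow_clog one_lt_two _)) _

theorem le_wakeRound (h : IsEstimate A n N) :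
    ((c + 3) * Nat.clog 2 (A ^ 2 * n) + 2) ^ 2 ≤ (electionParams c A).wakeRound N := by
  simp only [electionParams]
  gcongr ((c + 3) * Nat.clog 2 ?_ + 2) ^ 2
  exact h.le_pow_mul 2

theorem wakeRound_le (h : IsEstimate A n N) (hn : 2 ≤ n) :
    (electionParams c A).wakeRound N ≤ (phaseFactor c A * Nat.clog 2 n + 2) ^ 2 := by
  simp only [electionParams, phaseFactor, mul_assoc]
  gcongr
  exact (Nat.clog_mono_right 2 (h.pow_mul_le 3)).trans
    (clog_two_pow_mul_le_logFactor_mul hn le_rfl)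

end IsEstimate

theorem candidateHeads_le_coinCount (c A N : ℕ) :
    (electionParams c A).candidateHeads N ≤ (electionParams c A).coinCount N := by
  rcases A.eq_zero_or_pos with rfl | hA
  · simp [electionParams]
  calc Nat.log 2 (N / (A * (c + 2) * Nat.clog 2 (A * N))) ≤ Nat.log 2 N :=
        Nat.log_mono_right (Nat.div_le_self _ _)
    _ ≤ Nat.clog 2 N := Nat.log_le_clog 2 N
    _ ≤ Nat.clog 2 (A * N) := Nat.clog_mono_right 2 (Nat.le_mul_of_pos_left N hA)
    _ ≤ (c + 3) * Nat.clog 2 (A * N) := Nat.le_mul_of_pos_left _ (by omega)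

end Parameters

section Logarithms

variable {n : ℕ}

theorem log_le_clog_two (n : ℕ) : Real.log n ≤ Nat.clog 2 n := by
  have hlogb : Real.logb 2 n ≤ Nat.clog 2 n := by
    simpa only [← Real.natCeil_logb_natCast, Nat.cast_ofNat] using Nat.le_ceil (Real.logb 2 n)
  refine le_trans ?_ hlogb
  exact le_div_self (Real.log_natCast_nonneg n) (Real.log_pos one_lt_two)
    (Real.log_two_lt_d9.le.trans (by norm_num))

theorem log_two_le_log (hn : 2 ≤ n) : Real.log 2 ≤ Real.log n :=
  Real.log_le_log two_pos (by exact_mod_cast hn)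

theorem half_le_log (hn : 2 ≤ n) : 1 / 2 ≤ Real.log n := by
  linarith [log_two_le_log hn, Real.log_two_gt_d9]

theorem clog_two_le_log (hn : 2 ≤ n) : (Nat.clog 2 n : ℝ) ≤ 3 * Real.log n := by
  have hclog : (Nat.clog 2 n : ℝ) < Real.logb 2 n + 1 := by
    have h : 0 ≤ Real.logb 2 n := Real.logb_nonneg one_lt_two (by exact_mod_cast (by omega : 1 ≤ n))
    simpa only [← Real.natCeil_logb_natCast, Nat.cast_ofNat] using Nat.ceil_lt_add_one h
  have hlogb : Real.logb 2 n * Real.log 2 = Real.log n :=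
    div_mul_cancel₀ _ (Real.log_pos one_lt_two).ne'
  nlinarith [log_two_le_log hn, Real.log_two_gt_d9]

theorem clog_two_pow_le_log_pow (hn : 2 ≤ n) (j : ℕ) :
    (Nat.clog 2 n : ℝ) ^ j ≤ 2 * 3 ^ j * Real.log n ^ (j + 1) := by
  have hlog := half_le_log hn
  calc (Nat.clog 2 n : ℝ) ^ j ≤ (3 * Real.log n) ^ j := by
        gcongr
        exact clog_two_le_log hn
    _ = 3 ^ j * Real.log n ^ j * 1 := by rw [mul_pow, mul_one]
    _ ≤ 3 ^ j * Real.log n ^ j * (2 * Real.log n) := by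
        gcongr
        linarith
    _ = 2 * 3 ^ j * Real.log n ^ (j + 1) := by ring

end Logarithms

/-! ### The probability of failure -/

/-- With high probability there are fewer than `candidateFactor c A * Nat.clog 2 n` candidates. -/
def candidateFactor (c A : ℕ) : ℕ := 4 * A ^ 2 * (c + 2) * logFactor A + (c + 2)

/-- With high probability no node is near more than `nearFactor c A * Nat.clog 2 n` centres. -/
def nearFactor (c A : ℕ) : ℕ := 6 * (c + 3 + phaseFactor c A)

section Products

variable {ι : Type*} [Fintype ι] {p : ι → ℝ} {k : ℕ}

theorem prod_one_sub_le_one_div_card_pow [Nonempty ι] (h1 : ∀ i, p i ≤ 1)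
    (hp : ∀ i, 1 - p i ≤ Real.exp (-(k * Real.log (Fintype.card ι) / Fintype.card ι))) :
    ∏ i, (1 - p i) ≤ 1 / (Fintype.card ι : ℝ) ^ k := by
  have hcard : (0 : ℝ) < Fintype.card ι := Nat.cast_pos.2 Fintype.card_pos
  calc ∏ i, (1 - p i)
      ≤ ∏ _i : ι, Real.exp (-(k * Real.log (Fintype.card ι) / Fintype.card ι)) :=
        Finset.prod_le_prod (fun i _ => sub_nonneg.2 (h1 i)) fun i _ => hp i
    _ = Real.exp (-(k * Real.log (Fintype.card ι))) := by
        rw [Finset.prod_const, Finset.card_univ, ← Real.exp_nat_mul, mul_neg,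
          mul_div_cancel₀ _ hcard.ne']
    _ = 1 / (Fintype.card ι : ℝ) ^ k := by
        rw [Real.exp_neg, Real.exp_nat_mul, Real.exp_log hcard, one_div]

theorem prod_one_add_le_four_pow (h0 : ∀ i, 0 ≤ p i) (hp : ∑ i, p i ≤ k) :
    ∏ i, (1 + p i) ≤ 4 ^ k :=
  calc ∏ i, (1 + p i) ≤ ∏ i, Real.exp (p i) :=
        Finset.prod_le_prod (fun i _ => by linarith [h0 i]) fun i _ => by
          linarith [Real.add_one_le_exp (p i)]
    _ = Real.exp (∑ i, p i) := (Real.exp_sum _ _).symm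
    _ ≤ Real.exp k := Real.exp_le_exp.2 hp
    _ = Real.exp 1 ^ k := by rw [← Real.exp_nat_mul, mul_one]
    _ ≤ 4 ^ k := by
        gcongr
        linarith [Real.exp_one_lt_three]

end Products

namespace IsEstimate

variable {c A n N : ℕ}

theorem one_sub_one_div_two_pow_candidateHeads_le_exp (h : IsEstimate A n N) (hn : 2 ≤ n) :
    1 - 1 / 2 ^ (electionParams c A).candidateHeads N ≤
      Real.exp (-(((c + 2 : ℕ) : ℝ) * Real.log n / n)) := by
  have hcandidate : (electionParams c A).candidateHeads N =
    Nat.log 2 (N / (A * (c + 2) * Nat.clog 2 (A * N))) := rfl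
  set s := (electionParams c A).candidateHeads N
  set l := Nat.clog 2 (A * N)
  rcases Nat.eq_zero_or_pos (N / (A * (c + 2) * l)) with h0 | h0
  · rw [hcandidate, h0, Nat.log_zero_right, pow_zero, div_one, sub_self]
    positivity
  have hscale : 2 ^ s * ((c + 2) * l) ≤ n := by
    refine Nat.le_of_mul_le_mul_left ?_ (h.factor_pos (by omega))
    calc A * (2 ^ s * ((c + 2) * l)) = 2 ^ s * (A * (c + 2) * l) := by ring
      _ ≤ N / (A * (c + 2) * l) * (A * (c + 2) * l) :=
          Nat.mul_le_mul_right _ (hcandidate ▸ Nat.pow_log_le_self 2 h0.ne')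
      _ ≤ N := Nat.div_mul_le_self _ _
      _ ≤ A * n := h.mul_le
  have hlog : Real.log n ≤ l :=
    (log_le_clog_two n).trans (by exact_mod_cast Nat.clog_mono_right 2 h.le_mul)
  have hrate : ((c + 2 : ℕ) : ℝ) * Real.log n / n ≤ 1 / 2 ^ s := by
    rw [div_le_div_iff₀ (by positivity) (by positivity), one_mul, mul_comm]
    calc (2 : ℝ) ^ s * (((c + 2 : ℕ) : ℝ) * Real.log n) ≤ 2 ^ s * (((c + 2 : ℕ) : ℝ) * l) := by
          gcongr
      _ ≤ n := by exact_mod_cast hscale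
  linarith [Real.add_one_le_exp (-(((c + 2 : ℕ) : ℝ) * Real.log n / n))]

theorem one_div_two_pow_candidateHeads_le (h : IsEstimate A n N) (hn : 2 ≤ n) :
    (1 / 2 ^ (electionParams c A).candidateHeads N : ℝ) ≤
      (2 * A ^ 2 * (c + 2) * (logFactor A * Nat.clog 2 n) : ℕ) / n := by
  have hA : 0 < A := h.factor_pos (by omega)
  have hlog : 0 < Nat.clog 2 (A * N) := Nat.clog_pos one_lt_two (hn.trans h.le_mul)
  have hcandidate : (electionParams c A).candidateHeads N =
    Nat.log 2 (N / (A * (c + 2) * Nat.clog 2 (A * N))) := rfl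
  set s := (electionParams c A).candidateHeads N
  have hN : N < 2 ^ (s + 1) * (A * (c + 2) * Nat.clog 2 (A * N)) :=
    (Nat.div_lt_iff_lt_mul (by positivity)).1
      (hcandidate ▸ Nat.lt_pow_succ_log_self one_lt_two _)
  have hscale : n ≤ 2 * A ^ 2 * (c + 2) * (logFactor A * Nat.clog 2 n) * 2 ^ s :=
    calc n ≤ A * N := h.le_mul
      _ ≤ A * (2 ^ (s + 1) * (A * (c + 2) * Nat.clog 2 (A * N))) := Nat.mul_le_mul_left _ hN.le
      _ = 2 * A ^ 2 * (c + 2) * Nat.clog 2 (A * N) * 2 ^ s := by ring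
      _ ≤ _ := by
        gcongr
        exact h.clog_two_mul_le_logFactor_mul hn
  rw [div_le_div_iff₀ (by positivity) (by positivity), one_mul]
  exact_mod_cast hscale

end IsEstimate

section FailureProbability

variable {V : Type u} [Fintype V] {N : Network V} {c A : ℕ}

theorem sum_one_div_two_pow_coinCount_le [Nonempty V]
    (hN : ∀ v, IsEstimate A (Fintype.card V) (N.estimate v)) :
    ∑ v, (1 / 2 ^ (electionParams c A).coinCount (N.estimate v) : ℝ) ≤
      1 / (Fintype.card V : ℝ) ^ (c + 2) := by
  calc ∑ v, (1 / 2 ^ (electionParams c A).coinCount (N.estimate v) : ℝ)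
      ≤ ∑ _v : V, 1 / (Fintype.card V : ℝ) ^ (c + 3) := by
        gcongr with v
        exact_mod_cast (hN v).pow_le_two_pow_coinCount
    _ = 1 / (Fintype.card V : ℝ) ^ (c + 2) := by
        rw [Finset.sum_const, Finset.card_univ, nsmul_eq_mul]
        field_simp
        ring

theorem prod_one_sub_candidate_le [Nonempty V] (hcard : 2 ≤ Fintype.card V)
    (hN : ∀ v, IsEstimate A (Fintype.card V) (N.estimate v)) :
    ∏ v, (1 - 1 / 2 ^ (electionParams c A).candidateHeads (N.estimate v) : ℝ) ≤
      1 / (Fintype.card V : ℝ) ^ (c + 2) :=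
  prod_one_sub_le_one_div_card_pow
    (fun _ => div_le_one_of_le₀ (one_le_pow₀ one_le_two) (by positivity))
    fun v => (hN v).one_sub_one_div_two_pow_candidateHeads_le_exp hcard

theorem prod_one_add_candidate_div_le [Nonempty V] (hcard : 2 ≤ Fintype.card V)
    (hN : ∀ v, IsEstimate A (Fintype.card V) (N.estimate v)) :
    (∏ v, (1 + 1 / 2 ^ (electionParams c A).candidateHeads (N.estimate v) : ℝ)) /
      2 ^ (candidateFactor c A * Nat.clog 2 (Fintype.card V)) ≤
      1 / (Fintype.card V : ℝ) ^ (c + 2) := by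
  set n := Fintype.card V
  set q := 2 * A ^ 2 * (c + 2) * (logFactor A * Nat.clog 2 n)
  have hn : (0 : ℝ) < n := by positivity
  have hexpected :
      ∑ v, (1 / 2 ^ (electionParams c A).candidateHeads (N.estimate v) : ℝ) ≤ q := by
    refine (Finset.sum_le_card_nsmul _ _ _ fun v _ =>
      (hN v).one_div_two_pow_candidateHeads_le hcard).trans_eq ?_
    rw [Finset.card_univ, nsmul_eq_mul, mul_div_cancel₀ _ hn.ne']
  have hexponent : candidateFactor c A * Nat.clog 2 n = 2 * q + Nat.clog 2 n * (c + 2) := by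
    rw [candidateFactor]
    ring
  have hpow : (n : ℝ) ≤ 2 ^ Nat.clog 2 n := by exact_mod_cast Nat.le_pow_clog one_lt_two n
  calc _ ≤ (4 : ℝ) ^ q / 2 ^ (candidateFactor c A * Nat.clog 2 n) := by
        gcongr
        exact prod_one_add_le_four_pow (fun _ => by positivity) hexpected
    _ = 1 / (2 ^ Nat.clog 2 n) ^ (c + 2) := by
        rw [hexponent, pow_add, pow_mul 2 2, pow_mul 2 (Nat.clog 2 n), ← div_div]
        norm_num
    _ ≤ 1 / (n : ℝ) ^ (c + 2) := by gcongr

theorem card_mul_mul_seven_eighths_pow_le [Nonempty V] :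
    (Fintype.card V : ℝ) * ((phaseFactor c A * Nat.clog 2 (Fintype.card V) : ℕ) + 1) *
      (7 / 8) ^ (nearFactor c A * Nat.clog 2 (Fintype.card V)) ≤
      1 / (Fintype.card V : ℝ) ^ (c + 2) := by
  have hn : (0 : ℝ) < Fintype.card V := Nat.cast_pos.2 Fintype.card_pos
  set n := Fintype.card V
  set l := Nat.clog 2 n
  set K := phaseFactor c A * l
  have hpow : (n : ℝ) ≤ 2 ^ l := by exact_mod_cast Nat.le_pow_clog one_lt_two n
  have hK : (K : ℝ) + 1 ≤ 2 ^ K := by exact_mod_cast Nat.lt_two_pow_self (n := K)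
  have hdecay : (7 / 8 : ℝ) ^ (nearFactor c A * l) ≤ (1 / 2) ^ (l * (c + 3) + K) := by
    have hexponent : nearFactor c A * l = 6 * (l * (c + 3) + K) := by
      rw [nearFactor]
      ring
    rw [hexponent, pow_mul]
    gcongr
    norm_num
  rw [le_div_iff₀ (by positivity)]
  calc (n : ℝ) * (K + 1) * (7 / 8) ^ (nearFactor c A * l) * n ^ (c + 2)
      = n ^ (c + 3) * (K + 1) * (7 / 8) ^ (nearFactor c A * l) := by ring
    _ ≤ (2 ^ l) ^ (c + 3) * 2 ^ K * (1 / 2) ^ (l * (c + 3) + K) := by gcongr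
    _ = 1 := by
        rw [← pow_mul, ← pow_add, ← mul_pow]
        norm_num

theorem one_sub_le_coinMeasure_real_goodCoins_electionParams (hcard : 2 ≤ Fintype.card V)
    (hN : ∀ v, IsEstimate A (Fintype.card V) (N.estimate v)) :
    1 - 1 / (Fintype.card V : ℝ) ^ c ≤ (coinMeasure V).real {ω |
      GoodCoins N (electionParams c A) (phaseFactor c A * Nat.clog 2 (Fintype.card V))
        (nearFactor c A * Nat.clog 2 (Fintype.card V))
        (candidateFactor c A * Nat.clog 2 (Fintype.card V)) ω} := by
  have : Nonempty V := Fintype.card_pos_iff.1 (by omega)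
  have hn : (2 : ℝ) ≤ Fintype.card V := by exact_mod_cast hcard
  refine le_trans ?_ (one_sub_le_coinMeasure_real_goodCoins N (electionParams c A) _ _ _)
  have htotal : 4 * (1 / (Fintype.card V : ℝ) ^ (c + 2)) ≤ 1 / (Fintype.card V : ℝ) ^ c := by
    rw [mul_one_div, div_le_div_iff₀ (by positivity) (by positivity), pow_add, one_mul, mul_comm]
    gcongr
    nlinarith
  linarith [sum_one_div_two_pow_coinCount_le (c := c) hN,
    prod_one_sub_candidate_le (c := c) hcard hN,
    prod_one_add_candidate_div_le (c := c) hcard hN,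
    card_mul_mul_seven_eighths_pow_le (V := V) (c := c) (A := A)]

end FailureProbability

/-! ### The complexity -/

/-- With `k * Nat.clog 2 n` phases the algorithm takes at most
`roundFactor k * (D * Nat.clog 2 n + Nat.clog 2 n ^ 2)` rounds. -/
def roundFactor (k : ℕ) : ℕ := 3 * (k + 2) ^ 2 + 8 * (2 * k + 1) + 4

/-- With `k * Nat.clog 2 n` phases, `r * Nat.clog 2 n` centres near each node and
`m * Nat.clog 2 n` candidates the algorithm sends at most
`messageFactor k r m * (n * Nat.clog 2 n ^ 3)` messages. -/
def messageFactor (k r m : ℕ) : ℕ := 2 * r * ((k + 2) ^ 2 + 2 * m + 1)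

section Complexity

variable {l : ℕ}

theorem rounds_le_roundFactor_mul (k D : ℕ) (hl : 1 ≤ l) :
    3 * (k * l + 2) ^ 2 + 8 * ((2 * (k * l) + 1) * D) + 4 ≤ roundFactor k * (D * l + l ^ 2) := by
  have hphase : k * l + 2 ≤ (k + 2) * l := by nlinarith
  have hstretch : 2 * (k * l) + 1 ≤ (2 * k + 1) * l := by nlinarith
  have hone : 1 ≤ l ^ 2 := Nat.one_le_pow _ _ hl
  calc 3 * (k * l + 2) ^ 2 + 8 * ((2 * (k * l) + 1) * D) + 4
      ≤ 3 * ((k + 2) * l) ^ 2 + 8 * ((2 * k + 1) * l * D) + 4 * l ^ 2 := by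
        gcongr
        omega
    _ = (3 * (k + 2) ^ 2 + 4) * l ^ 2 + 8 * (2 * k + 1) * (D * l) := by ring
    _ ≤ roundFactor k * l ^ 2 + roundFactor k * (D * l) := by
        gcongr <;> rw [roundFactor] <;> omega
    _ = roundFactor k * (D * l + l ^ 2) := by ring

theorem messages_le_messageFactor_mul (n k r m : ℕ) (hl : 1 ≤ l) :
    2 * (n * (r * l)) * ((k * l + 2) ^ 2 + 2 * (m * l) + 1) ≤
      messageFactor k r m * (n * l ^ 3) := by
  have hphase : k * l + 2 ≤ (k + 2) * l := by nlinarith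
  have hself : l ≤ l ^ 2 := Nat.le_self_pow two_ne_zero l
  have hone : 1 ≤ l ^ 2 := Nat.one_le_pow _ _ hl
  calc 2 * (n * (r * l)) * ((k * l + 2) ^ 2 + 2 * (m * l) + 1)
      ≤ 2 * (n * (r * l)) * (((k + 2) * l) ^ 2 + 2 * (m * l ^ 2) + l ^ 2) := by gcongr
    _ = messageFactor k r m * (n * l ^ 3) := by rw [messageFactor]; ring

/-- A constant that bounds both the rounds and the messages. The factor `54` comes from replacing
`Nat.clog 2 n` by `3 * Real.log n`. -/
def complexityFactor (k r m : ℕ) : ℕ := 54 * (roundFactor k + messageFactor k r m)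

variable {n : ℕ}

theorem rounds_le_complexityFactor_mul (k r m D : ℕ) (hn : 2 ≤ n) :
    ((3 * (k * Nat.clog 2 n + 2) ^ 2 + 8 * ((2 * (k * Nat.clog 2 n) + 1) * D) + 4 : ℕ) : ℝ) ≤
      complexityFactor k r m * (D * Real.log n + Real.log n ^ 3) := by
  have hlog := half_le_log hn
  calc ((3 * (k * Nat.clog 2 n + 2) ^ 2 + 8 * ((2 * (k * Nat.clog 2 n) + 1) * D) + 4 : ℕ) : ℝ)
      ≤ roundFactor k * (D * Nat.clog 2 n + Nat.clog 2 n ^ 2) := by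
        exact_mod_cast rounds_le_roundFactor_mul k D (Nat.clog_pos one_lt_two hn)
    _ ≤ (roundFactor k + messageFactor k r m) *
          (D * (54 * Real.log n) + 54 * Real.log n ^ 3) := by
        gcongr
        · exact le_add_of_nonneg_right (Nat.cast_nonneg _)
        · linarith [clog_two_le_log hn]
        · exact (clog_two_pow_le_log_pow hn 2).trans (by gcongr; norm_num)
    _ = complexityFactor k r m * (D * Real.log n + Real.log n ^ 3) := by
        rw [complexityFactor]
        push_cast
        ring

theorem messages_le_complexityFactor_mul (k r m : ℕ) (hn : 2 ≤ n) :
    ((2 * (n * (r * Nat.clog 2 n)) *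
        ((k * Nat.clog 2 n + 2) ^ 2 + 2 * (m * Nat.clog 2 n) + 1) : ℕ) : ℝ) ≤
      complexityFactor k r m * (n * Real.log n ^ 4) :=
  calc _ ≤ (messageFactor k r m : ℝ) * (n * Nat.clog 2 n ^ 3) := by
        exact_mod_cast messages_le_messageFactor_mul n k r m (Nat.clog_pos one_lt_two hn)
    _ ≤ (roundFactor k + messageFactor k r m) * (n * (2 * 3 ^ 3 * Real.log n ^ 4)) := by
        gcongr
        · exact le_add_of_nonneg_left (Nat.cast_nonneg _)
        · exact clog_two_pow_le_log_pow hn 3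
    _ = complexityFactor k r m * (n * Real.log n ^ 4) := by
        rw [complexityFactor]
        push_cast
        ring

end Complexity

/-- The execution with the chosen parameters on a network whose estimates are correct up to the
factor `A`. -/
def executionOfEstimates (c : ℕ) {A : ℕ} {V : Type u} [Fintype V] (N : Network V)
    (ω : CoinTosses V) (hconn : N.graph.Connected) (hinj : Function.Injective N.id)
    (hcard : 2 ≤ Fintype.card V) (hN : ∀ v, IsEstimate A (Fintype.card V) (N.estimate v)) :
    Execution V where
  network := N
  ω := ω
  params := electionParams c A
  connected := hconn
  injective := hinj
  firstWake := ((c + 3) * Nat.clog 2 (A ^ 2 * Fintype.card V) + 2) ^ 2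
  lastWake := (phaseFactor c A * Nat.clog 2 (Fintype.card V) + 2) ^ 2
  firstWake_le v := (hN v).le_wakeRound
  le_lastWake v := (hN v).wakeRound_le hcard
  startPhase_lt v := Nat.pow_lt_pow_left
    (Nat.add_lt_add_of_le_of_lt ((Nat.sub_le _ _).trans (hN v).coinCount_le) one_lt_two)
    two_ne_zero

theorem mainTheorem5 (a : ℝ) (ha : 1 ≤ a) (c : ℕ) :
    ∃ (A : KT1LocalAlgorithm) (C : ℝ), ∀ (V : Type u) [Fintype V] (N : Network V),
      N.graph.Connected →
      Function.Injective N.id →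
      (∀ v : V, (Fintype.card V : ℝ) ≤ a * (N.estimate v : ℝ) ∧
        (N.estimate v : ℝ) ≤ a * (Fintype.card V : ℝ)) →
      1 - 1 / (Fintype.card V : ℝ) ^ c ≤ (coinMeasure V).real
        {ω : CoinTosses V |
          A.ElectsLeaderWithin N ω
            (C * ((N.graph.diam : ℝ) * Real.log (Fintype.card V : ℝ) +
              Real.log (Fintype.card V : ℝ) ^ 3)) ∧
          A.MessagesAtMost N ω
            (C * ((Fintype.card V : ℝ) * Real.log (Fintype.card V : ℝ) ^ 4))} := by
  refine ⟨electionAlgorithm (electionParams c ⌈a⌉₊), complexityFactor (phaseFactor c ⌈a⌉₊)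
    (nearFactor c ⌈a⌉₊) (candidateFactor c ⌈a⌉₊), fun V _ N hconn hinj hN => ?_⟩
  have hest : ∀ v, IsEstimate ⌈a⌉₊ (Fintype.card V) (N.estimate v) :=
    fun v => isEstimate_ceil (hN v).1 (hN v).2
  have : Nonempty V := hconn.nonempty
  rcases Nat.eq_or_lt_of_le (Fintype.card_pos (α := V)) with hcard | hcard
  · simp [← hcard]
  refine (one_sub_le_coinMeasure_real_goodCoins_electionParams hcard hest).trans
    (measureReal_mono fun ω hω => ?_)
  let E := executionOfEstimates c N ω hconn hinj hcard hest
  have hphases (v : V) :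
      E.startPhase v ≤ phaseFactor c ⌈a⌉₊ * Nat.clog 2 (Fintype.card V) :=
    (Nat.sub_le _ _).trans ((hest v).coinCount_le_phaseFactor_mul hcard)
  have hcandidates := candidateHeads_le_coinCount c ⌈a⌉₊
  exact ⟨GoodCoins.electsLeaderWithin (E := E) hω hphases hcandidates
      (rounds_le_complexityFactor_mul _ _ _ _ hcard),
    GoodCoins.messagesAtMost (E := E) hω hphases hcandidates
      (messages_le_complexityFactor_mul _ _ _ hcard)⟩
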